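/- Let $\lambda$ be a countable ordinal (e.g. $\omega$). All orders below are ordinals $<\lambda$. **Language.** The type of order $0$ is $0$ (individuals). For $0<\nu<\lambda$ the types of order $\nu$ are $\nu(\tau_1\dots\tau_n)$ with $\tau_1,\dots,\tau_n$ types of orders $<\nu$. Each type $\tau$ has countably many free variables $p^\tau,q^\tau,\dots$ and, disjoint from them, countably many bound variables $x^\tau,y^\tau,\dots$. *Formulas of order $\nu>0$*: $0$ and $1$; $p^\tau p_1^{\tau_1}\cdots p_n^{\tau_n}$ if $\tau=\mu(\tau_1\dots\tau_n)$ and $\mu\le\nu$; in a language with identity also $p^\tau=q^\tau$ if $\tau$ has order $\le\nu$; with $a,b,c(p^\tau)$ also $a\land b$, $a\lor b$, $\neg a$, $\forall_{x^\tau}c(x^\tau)$, $\exists_{x^\tau}c(x^\tau)$, provided $x^\tau$ does not occur in $c(p^\tau)$ and the order of $\tau$ is $<\nu$. Write $a\to b$ for $\neg a\lor b$ and $a\leftrightarrow b$ for $(a\to b)\land(b\to a)$. **Calculi.** Theorems are pairs of formulas, written $a\supset b$ ("$a$ implies $b$"). Axioms are instances (consisting of formulas) of $c\supset c$, $0\supset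 c$, $c\supset1$ and of further schemes. The rules are: from $a\supset c$ and $c\supset b$ infer $a\supset b$; from $a\supset b$ infer $a\land c\supset b$, $c\land a\supset b$, $a\supset b\lor c$, $a\supset c\lor b$; from $a\supset b_1$ and $a\supset b_2$ infer $a\supset b_1\land b_2$; from $a_1\supset b$ and $a_2\supset b$ infer $a_1\lor a_2\supset b$; from $a\land c\supset b$ infer $a\supset b\lor\neg c$; from $a\supset b\lor c$ infer $a\land\neg c\supset b$; from $a\supset\forall_{x^\tau}c(x^\tau)$ infer $a\supset c(p^\tau)$; from $\exists_{x^\tau}c(x^\tau)\supset b$ infer $c(p^\tau)\supset b$; from $a\supset c(p^\tau)$ infer $a\supset\forall_{x^\tau}c(x^\tau)$ if $p^\tau$ does not occur in $a$; from $c(p^\tau)\supset b$ infer $\exists_{x^\tau}c(x^\tau)\supset b$ if $p^\tau$ does not occur in $b$ (in all four quantifier rules $x^\tau$ does not occur in $c(p^\tau)$). The schemes of the *deductive calculus* $D$ (without identity) are - comprehension: $1\supset\exists_{x^\tau}\forall_{x_1^{\tau_1}}\cdots\forall_{x_n^{\tau_n}}(x^\tau x_1^{\tau_1}\cdots x_n^{\tau_n}\leftrightarrow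 c(x_1^{\tau_1},\dots,x_n^{\tau_n}))$ for $\tau=\nu(\tau_1\dots\tau_n)$ and $c(p_1^{\tau_1},\dots,p_n^{\tau_n})$ a formula of order $\nu$; - extensionality: $\forall_{x_1^{\tau_1}}\cdots\forall_{x_n^{\tau_n}}(p^\tau x_1^{\tau_1}\cdots x_n^{\tau_n}\leftrightarrow q^\tau x_1^{\tau_1}\cdots x_n^{\tau_n})\supset c(p^\tau)\to c(q^\tau)$ for $\tau=\nu(\tau_1\dots\tau_n)$; - infinity: for $\tau=1(00)$, $1\supset\exists_{x^\tau}(\forall_{x^0}\neg x^\tau x^0x^0\land\forall_{x^0}\exists_{y^0}x^\tau x^0y^0\land\forall_{x^0}\forall_{y^0}\forall_{z^0}((x^\tau x^0y^0\land x^\tau y^0z^0)\to x^\tau x^0z^0))$. Let $D^{=}$ be the calculus in the language with identity in which extensionality is replaced by the axioms of identity $(c_1)$ $1\supset p^\tau=p^\tau$ and $(c_2)$ $p^\tau=q^\tau\supset c(p^\tau)\to c(q^\tau)$. Let $D^{=,e}$ arise from $D^{=}$ by adding, for every type $\tau$, the axiom of equipotence: with $\nu$ the order of $\tau$ and $\sigma=\nu{+}1\,(\tau\,0)$,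 $$(e)\quad 1\supset\exists_{x^\sigma}\bigl(\forall_{x^\tau}\exists_{x^0}x^\sigma x^\tau x^0\land\forall_{z^0}\forall_{x^\tau}\forall_{y^\tau}((x^\sigma x^\tau z^0\land x^\sigma y^\tau z^0)\to x^\tau=y^\tau)\bigr).$$ Let $D^{=,e}_{\mathrm{ext}}$ be $D^{=,e}$ with extensionality retained as a further axiom scheme (for all formulas of the language with identity). **Theorem.** 1. $D^{=}$, $D^{=,e}$ and $D^{=,e}_{\mathrm{ext}}$ are consistent: $1\supset0$ is not a theorem of any of them. 2. Let $\nu\ge1$ with $\nu+3<\lambda$, and let $R_\nu$ be the following simple case of the axiom of reducibility, with $\rho=\nu{+}2\,(0)$ and $\tau=\nu\,(0)$: $$R_\nu:\quad\forall_{x^\rho}\exists_{x^\tau}\forall_{x^0}(x^\rho x^0\leftrightarrow x^\tau x^0).$$ Then $R_\nu$ is refutable in $D^{=,e}$, i.e. $R_\nu\supset0$ is a theorem of $D^{=,e}$. 3. Hence (with the same $\nu$) the axiom of reducibility is independent of the other axioms, in the sense that it is not derivable from them: $1\supset R_\nu$ is not a theorem of $D$, nor of $D^{=}$, $D^{=,e}$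 or $D^{=,e}_{\mathrm{ext}}$. -/

import Mathlib

open scoped Cardinal

namespace Ramified

/-! ### Types and variables -/

/-- Raw types: `ind` is the type `0` of individuals, `rel ν [τ₁, …, τₙ]` is `ν (τ₁ … τₙ)`. -/
inductive RType : Type 1
  | ind : RType
  | rel (ν : Ordinal.{0}) (args : List RType) : RType

/-- The order of a type. -/
def RType.order : RType → Ordinal.{0}
  | .ind => 0
  | .rel ν _ => ν

/-- The types proper, with orders below `Λ`: the arguments of a relation type of order `ν` are types
of orders less than `ν`. -/
inductive IsType (Λ : Ordinal.{0}) : RType → Prop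
  | ind : IsType Λ .ind
  | rel {ν : Ordinal.{0}} {τs : List RType} (hpos : 0 < ν) (hlt : ν < Λ)
      (htype : ∀ τ ∈ τs, IsType Λ τ) (horder : ∀ τ ∈ τs, τ.order < ν) : IsType Λ (.rel ν τs)

/-- A typed index: the data of a variable, free or bound. -/
structure TIndex : Type 1 where
  ty : RType
  idx : ℕ

/-- For every type there are countably many free variables and, disjoint from them, countably many
bound variables. -/
inductive Var : Type 1
  | free (p : TIndex) : Var
  | bound (x : TIndex) : Var

/-! ### Formulas -/

/-- Raw expressions. `app p [p₁, …, pₙ]` is `(p p₁ … pₙ)`, `eq p q` is `p = q`, `zero` is the false and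
`one` the true; the quantifiers bind bound variables. -/
inductive Expr : Type 1
  | zero : Expr
  | one : Expr
  | app (p : Var) (args : List Var) : Expr
  | eq (p q : Var) : Expr
  | and (a b : Expr) : Expr
  | or (a b : Expr) : Expr
  | neg (a : Expr) : Expr
  | all (x : TIndex) (a : Expr) : Expr
  | ex (x : TIndex) (a : Expr) : Expr

namespace Expr

/-- `a → b`, an abbreviation of `¬ a ∨ b`. -/
def imp (a b : Expr) : Expr := or (neg a) b

/-- `a ↔ b`, an abbreviation of `(¬ a ∨ b) ∧ (¬ b ∨ a)`. -/
def iff (a b : Expr) : Expr := and (imp a b) (imp b a)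

/-- `∀ x₁ … ∀ xₙ a`. -/
def alls (xs : List TIndex) (a : Expr) : Expr := xs.foldr all a

/-- The variable `v` occurs in the expression (be it only as the variable of a quantifier). -/
def Occurs (v : Var) : Expr → Prop
  | zero => False
  | one => False
  | app p args => v = p ∨ v ∈ args
  | eq p q => v = p ∨ v = q
  | and a b => Occurs v a ∨ Occurs v b
  | or a b => Occurs v a ∨ Occurs v b
  | neg a => Occurs v a
  | all x a => v = .bound x ∨ Occurs v a
  | ex x a => v = .bound x ∨ Occurs v a

open Classical in
/-- The variable `w` if `u = v`, and `u` otherwise. -/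
noncomputable def replaceVar (v w u : Var) : Var := if u = v then w else u

/-- Replacement of every occurrence of the free variable `p` by the variable `w`. -/
noncomputable def subst (p : TIndex) (w : Var) : Expr → Expr
  | zero => zero
  | one => one
  | app q args => app (replaceVar (.free p) w q) (args.map (replaceVar (.free p) w))
  | eq q r => eq (replaceVar (.free p) w q) (replaceVar (.free p) w r)
  | and a b => and (subst p w a) (subst p w b)
  | or a b => or (subst p w a) (subst p w b)
  | neg a => neg (subst p w a)
  | all x a => all x (subst p w a)
  | ex x a => ex x (subst p w a)

/-- `c(x₁, …, xₙ)` for `c = c(p₁, …, pₙ)`: replacement of the free variables `pᵢ` by the bound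
variables `xᵢ`. -/
noncomputable def bindAll : List TIndex → List TIndex → Expr → Expr
  | p :: ps, x :: xs, c => bindAll ps xs (subst p (.bound x) c)
  | _, _, c => c

end Expr

open Ramified.Expr

/-- `IsFormula Λ Id ν a`: the expression `a` is a formula of order `ν`, over the types with orders
below `Λ`. The proposition `Id` says whether the language has the relation of identity: the prime
formulas `p = q` are admitted exactly if `Id` holds. -/
inductive IsFormula (Λ : Ordinal.{0}) (Id : Prop) (ν : Ordinal.{0}) : Expr → Prop
  | zero : IsFormula Λ Id ν .zero
  | one : IsFormula Λ Id ν .one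
  | app {μ : Ordinal.{0}} {p : TIndex} {qs : List TIndex} (htype : IsType Λ p.ty)
      (hp : p.ty = .rel μ (qs.map TIndex.ty)) (horder : μ ≤ ν) :
      IsFormula Λ Id ν (.app (.free p) (qs.map Var.free))
  | eq {p q : TIndex} (hId : Id) (htype : IsType Λ p.ty) (hpq : p.ty = q.ty)
      (horder : p.ty.order ≤ ν) : IsFormula Λ Id ν (.eq (.free p) (.free q))
  | and {a b : Expr} (ha : IsFormula Λ Id ν a) (hb : IsFormula Λ Id ν b) :
      IsFormula Λ Id ν (.and a b)
  | or {a b : Expr} (ha : IsFormula Λ Id ν a) (hb : IsFormula Λ Id ν b) :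
      IsFormula Λ Id ν (.or a b)
  | neg {a : Expr} (ha : IsFormula Λ Id ν a) : IsFormula Λ Id ν (.neg a)
  | all {c : Expr} {p x : TIndex} (hc : IsFormula Λ Id ν c) (hx : ¬ Occurs (.bound x) c)
      (hpx : p.ty = x.ty) (htype : IsType Λ x.ty) (horder : x.ty.order < ν) :
      IsFormula Λ Id ν (.all x (subst p (.bound x) c))
  | ex {c : Expr} {p x : TIndex} (hc : IsFormula Λ Id ν c) (hx : ¬ Occurs (.bound x) c)
      (hpx : p.ty = x.ty) (htype : IsType Λ x.ty) (horder : x.ty.order < ν) :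
      IsFormula Λ Id ν (.ex x (subst p (.bound x) c))

/-- A formula is a formula of some order `ν` with `0 < ν < Λ`. -/
def Formula (Λ : Ordinal.{0}) (Id : Prop) (a : Expr) : Prop :=
  ∃ ν : Ordinal.{0}, 0 < ν ∧ ν < Λ ∧ IsFormula Λ Id ν a

/-! ### Theorems -/

/-- A scheme of axioms, as a set of pairs of expressions; only those instances count that are pairs
of formulas (see `Thm.ax`). -/
abbrev Scheme : Type 1 := Expr → Expr → Prop

/-- `Thm Λ Id Ax a b`: the pair of formulas `a, b` is a theorem of the calculus with the axioms
`c ⊃ c`, `0 ⊃ c`, `c ⊃ 1`, the further axioms `Ax`, and the rules of the deductive calculus.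
To be read: "the proposition `a` implies the proposition `b`". -/
inductive Thm (Λ : Ordinal.{0}) (Id : Prop) (Ax : Scheme) : Expr → Expr → Prop
  | refl {c : Expr} (hc : Formula Λ Id c) : Thm Λ Id Ax c c
  | zero_left {c : Expr} (hc : Formula Λ Id c) : Thm Λ Id Ax .zero c
  | one_right {c : Expr} (hc : Formula Λ Id c) : Thm Λ Id Ax c .one
  | ax {a b : Expr} (h : Ax a b) (ha : Formula Λ Id a) (hb : Formula Λ Id b) : Thm Λ Id Ax a b
  | cut {a b c : Expr} (h₁ : Thm Λ Id Ax a c) (h₂ : Thm Λ Id Ax c b) : Thm Λ Id Ax a b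
  | and_left₁ {a b c : Expr} (hc : Formula Λ Id c) (h : Thm Λ Id Ax a b) :
      Thm Λ Id Ax (.and a c) b
  | and_left₂ {a b c : Expr} (hc : Formula Λ Id c) (h : Thm Λ Id Ax a b) :
      Thm Λ Id Ax (.and c a) b
  | or_right₁ {a b c : Expr} (hc : Formula Λ Id c) (h : Thm Λ Id Ax a b) :
      Thm Λ Id Ax a (.or b c)
  | or_right₂ {a b c : Expr} (hc : Formula Λ Id c) (h : Thm Λ Id Ax a b) :
      Thm Λ Id Ax a (.or c b)
  | and_right {a b₁ b₂ : Expr} (h₁ : Thm Λ Id Ax a b₁) (h₂ : Thm Λ Id Ax a b₂) :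
      Thm Λ Id Ax a (.and b₁ b₂)
  | or_left {a₁ a₂ b : Expr} (h₁ : Thm Λ Id Ax a₁ b) (h₂ : Thm Λ Id Ax a₂ b) :
      Thm Λ Id Ax (.or a₁ a₂) b
  | neg_right {a b c : Expr} (h : Thm Λ Id Ax (.and a c) b) : Thm Λ Id Ax a (.or b (.neg c))
  | neg_left {a b c : Expr} (h : Thm Λ Id Ax a (.or b c)) : Thm Λ Id Ax (.and a (.neg c)) b
  | all_elim {a c : Expr} {p q x : TIndex} (hc : Formula Λ Id c) (hx : ¬ Occurs (.bound x) c)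
      (hp : p.ty = x.ty) (hq : q.ty = x.ty)
      (h : Thm Λ Id Ax a (.all x (subst p (.bound x) c))) :
      Thm Λ Id Ax a (subst p (.free q) c)
  | ex_elim {b c : Expr} {p q x : TIndex} (hc : Formula Λ Id c) (hx : ¬ Occurs (.bound x) c)
      (hp : p.ty = x.ty) (hq : q.ty = x.ty)
      (h : Thm Λ Id Ax (.ex x (subst p (.bound x) c)) b) :
      Thm Λ Id Ax (subst p (.free q) c) b
  | all_intro {a c : Expr} {p x : TIndex} (hx : ¬ Occurs (.bound x) c) (hp : p.ty = x.ty)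
      (hpa : ¬ Occurs (.free p) a) (hall : Formula Λ Id (.all x (subst p (.bound x) c)))
      (h : Thm Λ Id Ax a c) : Thm Λ Id Ax a (.all x (subst p (.bound x) c))
  | ex_intro {b c : Expr} {p x : TIndex} (hx : ¬ Occurs (.bound x) c) (hp : p.ty = x.ty)
      (hpb : ¬ Occurs (.free p) b) (hex : Formula Λ Id (.ex x (subst p (.bound x) c)))
      (h : Thm Λ Id Ax c b) : Thm Λ Id Ax (.ex x (subst p (.bound x) c)) b

/-! ### Axioms -/

/-- Comprehension: `1 ⊃ ∃ y ∀ x₁ … ∀ xₙ (y x₁ … xₙ ↔ c(x₁, …, xₙ))` for a formula `c(p₁, …, pₙ)` of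
order `ν` and `y` of type `ν (τ₁ … τₙ)`. -/
def Comprehension (Λ : Ordinal.{0}) (Id : Prop) : Scheme := fun a b =>
  ∃ (ν : Ordinal.{0}) (c : Expr) (ps xs : List TIndex) (y : TIndex),
    IsFormula Λ Id ν c ∧ ps.Nodup ∧ xs.Nodup ∧ xs.map TIndex.ty = ps.map TIndex.ty ∧
    (∀ x ∈ xs, ¬ Occurs (.bound x) c) ∧ y.ty = .rel ν (ps.map TIndex.ty) ∧
    a = .one ∧
    b = .ex y (alls xs (iff (.app (.bound y) (xs.map Var.bound)) (bindAll ps xs c)))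

/-- Extensionality: `∀ x₁ … ∀ xₙ (p x₁ … xₙ ↔ q x₁ … xₙ) ⊃ c(p) → c(q)`. -/
def Extensionality : Scheme := fun a b =>
  ∃ (ν : Ordinal.{0}) (c : Expr) (p q r : TIndex) (xs : List TIndex),
    xs.Nodup ∧ p.ty = .rel ν (xs.map TIndex.ty) ∧ q.ty = p.ty ∧ r.ty = p.ty ∧
    a = alls xs (iff (.app (.free p) (xs.map Var.bound)) (.app (.free q) (xs.map Var.bound))) ∧
    b = imp (subst r (.free p) c) (subst r (.free q) c)

/-- Infinity: some relation `r` of type `1 (0 0)` is irreflexive, total and transitive,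
`1 ⊃ ∃ r (∀ x ¬ r x x ∧ ∀ x ∃ y r x y ∧ ∀ x ∀ y ∀ z ((r x y ∧ r y z) → r x z))`. -/
def Infinity : Scheme := fun a b =>
  ∃ r x y z : TIndex,
    r.ty = .rel 1 [.ind, .ind] ∧ x.ty = .ind ∧ y.ty = .ind ∧ z.ty = .ind ∧
    x ≠ y ∧ x ≠ z ∧ y ≠ z ∧
    a = .one ∧
    b = .ex r (.and (.and
      (.all x (.neg (.app (.bound r) [.bound x, .bound x])))
      (.all x (.ex y (.app (.bound r) [.bound x, .bound y]))))
      (.all x (.all y (.all z (imp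
        (.and (.app (.bound r) [.bound x, .bound y]) (.app (.bound r) [.bound y, .bound z]))
        (.app (.bound r) [.bound x, .bound z]))))))

/-- First axiom of identity: `1 ⊃ p = p`. -/
def IdentityRefl : Scheme := fun a b =>
  ∃ p : TIndex, a = .one ∧ b = .eq (.free p) (.free p)

/-- Second axiom of identity: `p = q ⊃ c(p) → c(q)`. -/
def IdentitySubst : Scheme := fun a b =>
  ∃ (c : Expr) (p q r : TIndex), q.ty = p.ty ∧ r.ty = p.ty ∧
    a = .eq (.free p) (.free q) ∧ b = imp (subst r (.free p) c) (subst r (.free q) c)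

/-- Equipotence: for `τ` of order `ν` and `s` of type `ν+1 (τ 0)`,
`1 ⊃ ∃ s (∀ x ∃ u s x u ∧ ∀ z ∀ x ∀ y ((s x z ∧ s y z) → x = y))`
with `x, y` of type `τ` and `u, z` of type `0`. -/
def Equipotence : Scheme := fun a b =>
  ∃ (τ : RType) (s x y u z : TIndex),
    s.ty = .rel (τ.order + 1) [τ, .ind] ∧ x.ty = τ ∧ y.ty = τ ∧ u.ty = .ind ∧ z.ty = .ind ∧
    x ≠ y ∧ x ≠ u ∧ x ≠ z ∧ y ≠ z ∧
    a = .one ∧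
    b = .ex s (.and
      (.all x (.ex u (.app (.bound s) [.bound x, .bound u])))
      (.all z (.all x (.all y (imp
        (.and (.app (.bound s) [.bound x, .bound z]) (.app (.bound s) [.bound y, .bound z]))
        (.eq (.bound x) (.bound y)))))))

/-- The (simple case of the) axiom of reducibility, `∀ x ∃ y ∀ z (x z ↔ y z)` with `x` of type
`ν+2 (0)`, `y` of type `ν (0)` and `z` of type `0`; the bound variables have the indices `i, j, k`. -/
def reducibility (ν : Ordinal.{0}) (i j k : ℕ) : Expr :=
  .all ⟨.rel (ν + 2) [.ind], i⟩ (.ex ⟨.rel ν [.ind], j⟩ (.all ⟨.ind, k⟩ (iff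
    (.app (.bound ⟨.rel (ν + 2) [.ind], i⟩) [.bound ⟨.ind, k⟩])
    (.app (.bound ⟨.rel ν [.ind], j⟩) [.bound ⟨.ind, k⟩]))))

/-! ### Calculi -/

/-- The deductive calculus (without identity): comprehension, extensionality, infinity. -/
def DeductiveThm (Λ : Ordinal.{0}) : Expr → Expr → Prop :=
  Thm Λ False (fun a b => Comprehension Λ False a b ∨ Extensionality a b ∨ Infinity a b)

/-- The deductive calculus with identity, the axioms of identity replacing extensionality. -/
def IdentityThm (Λ : Ordinal.{0}) : Expr → Expr → Prop :=
  Thm Λ True (fun a b => Comprehension Λ True a b ∨ Infinity a b ∨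
    IdentityRefl a b ∨ IdentitySubst a b)

/-- The deductive calculus with identity and the axiom of equipotence, the axioms of identity
replacing extensionality. -/
def EquipotenceThm (Λ : Ordinal.{0}) : Expr → Expr → Prop :=
  Thm Λ True (fun a b => Comprehension Λ True a b ∨ Infinity a b ∨
    IdentityRefl a b ∨ IdentitySubst a b ∨ Equipotence a b)

/-- The full deductive calculus, extensionality retained, extended by identity and its axioms and by
the axiom of equipotence. -/
def ExtendedThm (Λ : Ordinal.{0}) : Expr → Expr → Prop :=
  Thm Λ True (fun a b => Comprehension Λ True a b ∨ Extensionality a b ∨ Infinity a b ∨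
    IdentityRefl a b ∨ IdentitySubst a b ∨ Equipotence a b)

/-- A calculus is consistent if `1 ⊃ 0` is not a theorem. -/
def Consistent (T : Expr → Expr → Prop) : Prop := ¬ T .one .zero

/-- The formula `a` is refutable if `a ⊃ 0` is a theorem. -/
def Refutable (T : Expr → Expr → Prop) (a : Expr) : Prop := T a .zero

/-- The formula `a` is provable if `1 ⊃ a` is a theorem. -/
def Provable (T : Expr → Expr → Prop) (a : Expr) : Prop := T .one a

end Ramified

namespace Ramified

open Ramified.Expr

/-! ### Countable families of relations closed under definability -/

/-! Consistency comes from a model in which every object of every type is a natural number. The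
individuals are all numbers. By recursion on the order `ν`, `rels Λ ν` enumerates the relations that
are first-order definable, with numbers as constants, from the objects of lower orders together with
equality and `<` on numbers; since `Λ` is countable there are countably many types, hence countably
many such relations. An object of a relation type is the least index of its extension.

This coding yields all the axioms. Least indices are unique, so coextensive objects are the same
number, and extensionality and identity hold together. Each domain is a set of numbers, so equality
of numbers is itself an injection into the individuals, which gives equipotence; `<` gives infinity.
Comprehension is the heart (`exists_coord`): a formula of order `ν` quantifies only over orders
below `ν`, and a variable of order `ν` in head position is a parameter, hence already names a member
of the family, which is closed under definability. Soundness (`Thm.sound`) then makes the largest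
calculus consistent, and the others embed in it.

The refutation is Cantor's diagonal argument inside the calculus (`refutable_reducibility`).
Equipotence labels the sets of order `ν` by individuals, distinct sets sharing no label. The set of
individuals that label some set not containing them exists by comprehension at order `ν+2`;
reducibility replaces it by a set `Q` of order `ν`, and a label of `Q` belongs to `Q` if and only if
it does not. A proof of reducibility would therefore make the consistent calculus inconsistent. -/

/-- The value of a coordinate (`inl`) or a constant (`inr`) at a list of numbers. -/
def coord (t : List ℕ) : ℕ ⊕ ℕ → ℕ
  | .inl i => t.getD i 0
  | .inr m => m

/-- One step of closing a family of relations under Boolean operations, relativized existential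
quantification and substitution of coordinates and constants. -/
def closureStep {ι : Type*} (D : ι → Set ℕ) (S : Set (Set (List ℕ))) : Set (Set (List ℕ)) :=
  S ∪ (compl '' S ∪ (Set.image2 (· ∩ ·) S S ∪
    ((⋃ i, (fun A => {t | ∃ n ∈ D i, n :: t ∈ A}) '' S) ∪
      ⋃ qs : List (ℕ ⊕ ℕ), (fun A => {t | qs.map (coord t) ∈ A}) '' S)))

/-- The relations definable from the relations `B i`, equality and the order of numbers, the
quantifiers ranging over the sets `D i`. -/
def definableFamily {ι : Type*} (B : ι → Set (List ℕ)) (D : ι → Set ℕ) : Set (Set (List ℕ)) :=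
  ⋃ k : ℕ, (closureStep D)^[k]
    (Set.range B ∪ {{t | ∃ a, t = [a, a]}, {t | ∃ a b, a < b ∧ t = [a, b]}})

section definableFamily

variable {ι : Type*} {B : ι → Set (List ℕ)} {D : ι → Set ℕ}

theorem countable_definableFamily [Countable ι] : (definableFamily B D).Countable := by
  refine Set.countable_iUnion fun k => ?_
  induction k with
  | zero => exact (Set.countable_range B).union (Set.toFinite _).countable
  | succ k ih =>
    rw [Function.iterate_succ_apply']
    exact ih.union ((ih.image _).union ((ih.image2 ih _).union
      ((Set.countable_iUnion fun _ => ih.image _).union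
        (Set.countable_iUnion fun _ => ih.image _))))

theorem definableFamily_base (i : ι) : B i ∈ definableFamily B D :=
  Set.mem_iUnion.2 ⟨0, Or.inl ⟨i, rfl⟩⟩

theorem definableFamily_eq : {t | ∃ a, t = [a, a]} ∈ definableFamily B D :=
  Set.mem_iUnion.2 ⟨0, Or.inr (Or.inl rfl)⟩

theorem definableFamily_lt : {t | ∃ a b, a < b ∧ t = [a, b]} ∈ definableFamily B D :=
  Set.mem_iUnion.2 ⟨0, Or.inr (Or.inr rfl)⟩

theorem definableFamily_step {A : Set (List ℕ)} {k : ℕ}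
    {S : Set (Set (List ℕ))} (h : A ∈ closureStep D ((closureStep D)^[k] S))
    (hS : S = Set.range B ∪ {{t | ∃ a, t = [a, a]}, {t | ∃ a b, a < b ∧ t = [a, b]}}) :
    A ∈ definableFamily B D := by
  subst hS
  exact Set.mem_iUnion.2 ⟨k + 1, by rwa [Function.iterate_succ_apply']⟩

theorem definableFamily_compl {A : Set (List ℕ)} (h : A ∈ definableFamily B D) :
    Aᶜ ∈ definableFamily B D := by
  obtain ⟨k, hk⟩ := Set.mem_iUnion.1 h
  exact definableFamily_step (k := k) (Or.inr (Or.inl ⟨A, hk, rfl⟩)) rfl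

theorem definableFamily_inter {A A' : Set (List ℕ)} (h : A ∈ definableFamily B D)
    (h' : A' ∈ definableFamily B D) : A ∩ A' ∈ definableFamily B D := by
  -- The stages increase, so both sets already lie in a common stage.
  have mono : Monotone fun k => (closureStep D)^[k]
      (Set.range B ∪ {{t | ∃ a, t = [a, a]}, {t | ∃ a b, a < b ∧ t = [a, b]}}) := by
    refine monotone_nat_of_le_succ fun k => ?_
    simp only [Function.iterate_succ_apply']
    exact Set.subset_union_left
  obtain ⟨k, hk⟩ := Set.mem_iUnion.1 h
  obtain ⟨l, hl⟩ := Set.mem_iUnion.1 h'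
  exact definableFamily_step (k := max k l)
    (Or.inr (Or.inr (Or.inl ⟨A, mono (le_max_left k l) hk, A', mono (le_max_right k l) hl, rfl⟩)))
    rfl

theorem definableFamily_ex {A : Set (List ℕ)} (h : A ∈ definableFamily B D) (i : ι) :
    {t | ∃ n ∈ D i, n :: t ∈ A} ∈ definableFamily B D := by
  obtain ⟨k, hk⟩ := Set.mem_iUnion.1 h
  exact definableFamily_step (k := k)
    (Or.inr (Or.inr (Or.inr (Or.inl (Set.mem_iUnion.2 ⟨i, A, hk, rfl⟩))))) rfl

theorem definableFamily_subst {A : Set (List ℕ)} (h : A ∈ definableFamily B D)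
    (qs : List (ℕ ⊕ ℕ)) : {t | qs.map (coord t) ∈ A} ∈ definableFamily B D := by
  obtain ⟨k, hk⟩ := Set.mem_iUnion.1 h
  exact definableFamily_step (k := k)
    (Or.inr (Or.inr (Or.inr (Or.inr (Set.mem_iUnion.2 ⟨qs, A, hk, rfl⟩))))) rfl

/-- Besides serving as truth, this makes the family nonempty, as an enumeration by all numbers
requires. -/
theorem definableFamily_univ : Set.univ ∈ definableFamily B D := by
  have h := definableFamily_compl (definableFamily_inter (definableFamily_eq (B := B) (D := D))
    (definableFamily_compl definableFamily_eq))
  rwa [Set.inter_compl_self, Set.compl_empty] at h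

end definableFamily

/-! ### Countably many types -/

/-- A type is a finite tree labelled by orders, so `ω` rounds of forming relation types suffice even
when the orders are transfinite. -/
theorem countable_setOf_isType {Λ : Ordinal.{0}} (hΛ : Λ.card ≤ ℵ₀) :
    {τ | IsType Λ τ}.Countable := by
  let step : Set RType → Set RType := fun S =>
    S ∪ Set.image2 RType.rel (Set.Iio Λ) {l | ∀ τ ∈ l, τ ∈ S}
  have hIio : (Set.Iio Λ).Countable := by
    rw [← Cardinal.le_aleph0_iff_set_countable, Cardinal.mk_Iio_ordinal]
    rwa [Cardinal.lift_le_aleph0]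
  have hlist : ∀ S : Set RType, S.Countable → {l : List RType | ∀ τ ∈ l, τ ∈ S}.Countable := by
    intro S hS
    have := hS.to_subtype
    refine (Set.countable_range fun l : List S => l.map Subtype.val).mono fun l hl => ?_
    exact ⟨l.attach.map fun x => ⟨x.1, hl x.1 x.2⟩, by simp⟩
  have hcount : (⋃ k : ℕ, step^[k] {RType.ind}).Countable := by
    refine Set.countable_iUnion fun k => ?_
    induction k with
    | zero => exact Set.countable_singleton _
    | succ k ih =>
      rw [Function.iterate_succ_apply']
      exact ih.union (hIio.image2 (hlist _ ih) _)
  have mono : Monotone fun k => step^[k] {RType.ind} := by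
    refine monotone_nat_of_le_succ fun k => ?_
    simp only [Function.iterate_succ_apply']
    exact Set.subset_union_left
  refine hcount.mono fun τ hτ => ?_
  induction hτ with
  | ind => exact Set.mem_iUnion.2 ⟨0, rfl⟩
  | @rel ν τs _ hlt _ _ ih =>
    -- The argument list is finite, so one stage contains all its members.
    have key : ∃ k, ∀ τ ∈ τs, τ ∈ step^[k] {RType.ind} := by
      clear * - ih mono
      induction τs with
      | nil => exact ⟨0, by simp⟩
      | cons σ l ihl =>
        obtain ⟨k, hk⟩ := ihl fun τ h => ih τ (List.mem_cons_of_mem _ h)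
        obtain ⟨m, hm⟩ := Set.mem_iUnion.1 (ih σ List.mem_cons_self)
        refine ⟨max k m, fun τ h => ?_⟩
        rcases List.mem_cons.1 h with rfl | h
        · exact mono (le_max_right k m) hm
        · exact mono (le_max_left k m) (hk τ h)
    obtain ⟨k, hk⟩ := key
    refine Set.mem_iUnion.2 ⟨k + 1, ?_⟩
    rw [Function.iterate_succ_apply']
    exact Or.inr ⟨ν, hlt, τs, hk, rfl⟩

/-! ### Domains -/

/-- The numbers that serve as objects of a type, `E ν` being an enumeration of the relations of
order `ν`: each relation is represented by its least number. -/
def dom (E : Ordinal.{0} → ℕ → Set (List ℕ)) : RType → Set ℕ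
  | .ind => Set.univ
  | .rel ν args => {m | ∀ k < m,
      E ν k ∩ {l | List.Forall₂ (fun a S => a ∈ S) l (args.map (dom E))} ≠
        E ν m ∩ {l | List.Forall₂ (fun a S => a ∈ S) l (args.map (dom E))}}

/-- The lists of objects of the given types. -/
def typed (E : Ordinal.{0} → ℕ → Set (List ℕ)) (args : List RType) : Set (List ℕ) :=
  {l | List.Forall₂ (fun a τ => a ∈ dom E τ) l args}

/-- The extension of a number, considered as an object of the given type. -/
def ext (E : Ordinal.{0} → ℕ → Set (List ℕ)) : RType → ℕ → Set (List ℕ)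
  | .ind, _ => ∅
  | .rel ν args, m => E ν m ∩ typed E args

section dom

variable {E : Ordinal.{0} → ℕ → Set (List ℕ)}

theorem mem_dom_rel {ν : Ordinal.{0}} {args : List RType} {m : ℕ} :
    m ∈ dom E (.rel ν args) ↔ ∀ k < m, ext E (.rel ν args) k ≠ ext E (.rel ν args) m := by
  rw [dom]
  simp [ext, typed]

theorem zero_mem_dom (τ : RType) : 0 ∈ dom E τ := by
  cases τ with
  | ind => simp [dom]
  | rel ν args => exact mem_dom_rel.2 fun k hk => absurd hk (Nat.not_lt_zero k)

/-- Both numbers are the least index of the same relation. This makes the model extensional. -/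
theorem ext_injOn {ν : Ordinal.{0}} {args : List RType} {m n : ℕ} (hm : m ∈ dom E (.rel ν args))
    (hn : n ∈ dom E (.rel ν args)) (h : ext E (.rel ν args) m = ext E (.rel ν args) n) :
    m = n := by
  rcases lt_trichotomy m n with hlt | rfl | hlt
  · exact absurd h (mem_dom_rel.1 hn m hlt)
  · rfl
  · exact absurd h.symm (mem_dom_rel.1 hm n hlt)

theorem exists_mem_dom {ν : Ordinal.{0}} {args : List RType} {A : Set (List ℕ)}
    (h : A ∈ Set.range (E ν)) :
    ∃ m ∈ dom E (.rel ν args), ext E (.rel ν args) m = A ∩ typed E args := by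
  classical
  obtain ⟨k, rfl⟩ := h
  have hex : ∃ m, ext E (.rel ν args) m = E ν k ∩ typed E args := ⟨k, rfl⟩
  refine ⟨Nat.find hex, mem_dom_rel.2 fun j hj h => ?_, Nat.find_spec hex⟩
  exact Nat.find_min hex hj (h.trans (Nat.find_spec hex))

/-- Argument types have smaller orders, so a domain depends only on the enumerations up to the order
of its type. Truncating the enumerations at `ν` thus leaves the domains below `ν` unchanged. -/
theorem dom_congr {E' : Ordinal.{0} → ℕ → Set (List ℕ)} {Λ : Ordinal.{0}} {τ : RType}
    (hτ : IsType Λ τ) (h : ∀ μ ≤ τ.order, E μ = E' μ) : dom E τ = dom E' τ := by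
  induction hτ with
  | ind => simp [dom]
  | @rel ν τs _ _ _ horder ih =>
    have hmap : τs.map (dom E) = τs.map (dom E') := List.map_congr_left fun τ hτ =>
      ih τ hτ fun μ hμ => h μ (hμ.trans (horder τ hτ).le)
    rw [dom, dom, hmap, h ν le_rfl]

theorem ext_congr {E' : Ordinal.{0} → ℕ → Set (List ℕ)} {Λ : Ordinal.{0}} {τ : RType}
    (hτ : IsType Λ τ) (h : ∀ μ ≤ τ.order, E μ = E' μ) : ext E τ = ext E' τ := by
  cases hτ with
  | ind => funext m; simp [ext]
  | @rel ν τs _ _ htype horder =>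
    have : typed E τs = typed E' τs := by
      ext l
      simp only [typed, ← List.forall₂_map_right_iff (f := dom _) (R := fun a S => a ∈ S), Set.mem_ofPred_eq]
      rw [List.map_congr_left fun τ hτ =>
        dom_congr (htype τ hτ) fun μ hμ => h μ (hμ.trans (horder τ hτ).le)]
    funext m
    simp only [ext, this, h ν le_rfl]

end dom

/-! ### The enumerations -/

/-- The relations definable from the objects of the types below `Λ`. -/
def definableFrom (Λ : Ordinal.{0}) (E : Ordinal.{0} → ℕ → Set (List ℕ)) : Set (Set (List ℕ)) :=
  definableFamily (ι := {τ // IsType Λ τ}) (fun τ => {t | ∃ m l, l ∈ ext E τ m ∧ t = m :: l})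
    fun τ => dom E τ

open Classical in
/-- An enumeration of the given family, if there is one. -/
noncomputable def enumeration (F : Set (Set (List ℕ))) : ℕ → Set (List ℕ) :=
  if h : ∃ f : ℕ → Set (List ℕ), F = Set.range f then h.choose else fun _ => ∅

open Classical in
/-- An enumeration of the relations of order `ν` of the model, those definable from the objects of
lower orders. -/
noncomputable def rels (Λ ν : Ordinal.{0}) : ℕ → Set (List ℕ) :=
  enumeration (definableFrom Λ fun μ => if μ < ν then rels Λ μ else fun _ => ∅)
termination_by ν

/-- The recursion equation in usable form. `E` is `rels Λ` cut off at `ν`; only its values below `ν`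
matter later. Countability ensures that `enumeration` does not take its default value. -/
theorem range_rels {Λ : Ordinal.{0}} (hΛ : Λ.card ≤ ℵ₀) (ν : Ordinal.{0}) :
    ∃ E, (∀ μ < ν, E μ = rels Λ μ) ∧ Set.range (rels Λ ν) = definableFrom Λ E := by
  classical
  refine ⟨fun μ => if μ < ν then rels Λ μ else fun _ => ∅, fun μ hμ => if_pos hμ, ?_⟩
  have : Countable {τ // IsType Λ τ} := (countable_setOf_isType hΛ).to_subtype
  have hex := (countable_definableFamily (ι := {τ // IsType Λ τ})
    (B := fun τ => {t | ∃ m l, l ∈ ext (fun μ => if μ < ν then rels Λ μ else fun _ => ∅) τ m ∧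
      t = m :: l})
    (D := fun τ => dom (fun μ => if μ < ν then rels Λ μ else fun _ => ∅) τ)).exists_eq_range
    ⟨_, definableFamily_univ⟩
  rw [rels, enumeration]
  unfold definableFrom
  rw [dif_pos hex]
  exact hex.choose_spec.symm

/-! ### Satisfaction -/

/-- The type of a variable. -/
def Var.type : Var → RType
  | .free p => p.ty
  | .bound x => x.ty

open Classical in
/-- The valuation `v` changed to `n` at the variable `u`. -/
noncomputable def assign (v : Var → ℕ) (u : Var) (n : ℕ) : Var → ℕ :=
  fun w => if w = u then n else v w

/-- Satisfaction of an expression by a valuation. -/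
noncomputable def Sat (E : Ordinal.{0} → ℕ → Set (List ℕ)) : Expr → (Var → ℕ) → Prop
  | .zero, _ => False
  | .one, _ => True
  | .app p args, v => args.map v ∈ ext E p.type (v p)
  | .eq p q, v => v p = v q
  | .and a b, v => Sat E a v ∧ Sat E b v
  | .or a b, v => Sat E a v ∨ Sat E b v
  | .neg a, v => ¬ Sat E a v
  | .all x a, v => ∀ n ∈ dom E x.ty, Sat E a (assign v (.bound x) n)
  | .ex x a, v => ∃ n ∈ dom E x.ty, Sat E a (assign v (.bound x) n)

/-- The valuation takes every variable to an object of its type. -/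
def Admissible (E : Ordinal.{0} → ℕ → Set (List ℕ)) (v : Var → ℕ) : Prop :=
  ∀ u, v u ∈ dom E u.type

section Sat

variable {E : Ordinal.{0} → ℕ → Set (List ℕ)}

@[simp] theorem assign_self (v : Var → ℕ) (u : Var) (n : ℕ) : assign v u n u = n := by
  simp [assign]

theorem assign_of_ne {u w : Var} (h : w ≠ u) (v : Var → ℕ) (n : ℕ) : assign v u n w = v w := by
  simp [assign, h]

theorem assign_comm {u w : Var} (h : u ≠ w) (v : Var → ℕ) (m n : ℕ) :
    assign (assign v u m) w n = assign (assign v w n) u m := by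
  funext z
  by_cases h1 : z = u <;> by_cases h2 : z = w <;> simp_all [assign]

theorem Admissible.assign {v : Var → ℕ} (hv : Admissible E v) {u : Var} {n : ℕ}
    (hn : n ∈ dom E u.type) : Admissible E (assign v u n) := by
  intro w
  by_cases h : w = u
  · subst h; simpa
  · rw [assign_of_ne h]; exact hv w

theorem sat_congr {a : Expr} {v w : Var → ℕ} (h : ∀ u, Occurs u a → v u = w u) :
    Sat E a v ↔ Sat E a w := by
  induction a generalizing v w with
  | zero => rfl
  | one => rfl
  | app p args =>
    have h1 : args.map v = args.map w := List.map_congr_left fun u hu => h u (Or.inr hu)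
    simp only [Sat, h1, h p (Or.inl rfl)]
  | eq p q => simp only [Sat, h p (Or.inl rfl), h q (Or.inr rfl)]
  | and a b iha ihb =>
    simp only [Sat, iha fun u hu => h u (Or.inl hu), ihb fun u hu => h u (Or.inr hu)]
  | or a b iha ihb =>
    simp only [Sat, iha fun u hu => h u (Or.inl hu), ihb fun u hu => h u (Or.inr hu)]
  | neg a iha => simp only [Sat, iha h]
  | all x a iha | ex x a iha =>
    simp only [Sat]
    have (n : ℕ) : Sat E a (assign v (.bound x) n) ↔ Sat E a (assign w (.bound x) n) := by
      refine iha fun u hu => ?_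
      by_cases hx : u = .bound x
      · subst hx; simp
      · rw [assign_of_ne hx, assign_of_ne hx, h u (Or.inr hu)]
    simp only [this]

theorem sat_assign_of_not_occurs {a : Expr} {v : Var → ℕ} {u : Var} {n : ℕ}
    (h : ¬ Occurs u a) : Sat E a (assign v u n) ↔ Sat E a v :=
  sat_congr fun w hw => assign_of_ne (fun e : w = u => h (e ▸ hw)) v n

/-! ### Substitution and simultaneous assignment -/

theorem apply_replaceVar {v : Var → ℕ} {p : TIndex} {w u : Var} :
    v (replaceVar (.free p) w u) = assign v (.free p) (v w) u := by
  unfold replaceVar assign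
  split <;> rfl

theorem type_replaceVar {p : TIndex} {w u : Var} (hw : w.type = p.ty) :
    (replaceVar (.free p) w u).type = u.type := by
  unfold replaceVar
  split_ifs with h
  · rw [h, hw]; rfl
  · rfl

/-- `hcap` excludes capture: no quantifier of `a` uses `w`, so the assignments it makes leave the
value of `w` alone. -/
theorem sat_subst {a : Expr} {p : TIndex} {w : Var} (hw : w.type = p.ty)
    (hcap : ∀ x : TIndex, w = .bound x → ¬ Occurs (.bound x) a) {v : Var → ℕ} :
    Sat E (subst p w a) v ↔ Sat E a (assign v (.free p) (v w)) := by
  induction a generalizing v with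
  | zero => rfl
  | one => rfl
  | app q args =>
    have : (args.map (replaceVar (.free p) w)).map v =
        args.map (assign v (.free p) (v w)) := by
      rw [List.map_map]
      exact List.map_congr_left fun u _ => apply_replaceVar
    simp only [subst, Sat, this, type_replaceVar hw, apply_replaceVar]
  | eq q r => simp only [subst, Sat, apply_replaceVar]
  | and a b iha ihb =>
    simp only [subst, Sat, iha fun x hx h => hcap x hx (Or.inl h),
      ihb fun x hx h => hcap x hx (Or.inr h)]
  | or a b iha ihb =>
    simp only [subst, Sat, iha fun x hx h => hcap x hx (Or.inl h),
      ihb fun x hx h => hcap x hx (Or.inr h)]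
  | neg a iha => simp only [subst, Sat, iha hcap]
  | all y a iha | ex y a iha =>
    have hy : w ≠ .bound y := fun e => hcap y e (Or.inl rfl)
    simp only [subst, Sat, iha fun x hx h => hcap x hx (Or.inr h), assign_of_ne hy,
      assign_comm (u := .bound y) (w := .free p) (by simp)]

theorem sat_subst_free {a : Expr} {p q : TIndex} (h : q.ty = p.ty) {v : Var → ℕ} :
    Sat E (subst p (.free q) a) v ↔ Sat E a (assign v (.free p) (v (.free q))) :=
  sat_subst (w := .free q) h fun _ hx => by simp at hx

theorem sat_subst_bound {a : Expr} {p x : TIndex} (h : p.ty = x.ty)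
    (hx : ¬ Occurs (.bound x) a) {v : Var → ℕ} :
    Sat E (subst p (.bound x) a) v ↔ Sat E a (assign v (.free p) (v (.bound x))) :=
  sat_subst (w := .bound x) h.symm fun y hy => by cases hy; exact hx

theorem sat_subst_bound_assign {a : Expr} {p x : TIndex} (h : p.ty = x.ty)
    (hx : ¬ Occurs (.bound x) a) {v : Var → ℕ} {n : ℕ} :
    Sat E (subst p (.bound x) a) (assign v (.bound x) n) ↔ Sat E a (assign v (.free p) n) := by
  rw [sat_subst_bound h hx, assign_self, assign_comm (by simp), sat_assign_of_not_occurs hx]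

/-- Quantified formulas arise by binding a free variable, so quantification amounts to varying that
free variable in `c`. Inductions on `IsFormula` therefore never meet a loose bound variable. -/
theorem sat_all_subst {a : Expr} {p x : TIndex} (h : p.ty = x.ty) (hx : ¬ Occurs (.bound x) a)
    {v : Var → ℕ} : Sat E (.all x (subst p (.bound x) a)) v ↔
      ∀ n ∈ dom E x.ty, Sat E a (assign v (.free p) n) := by
  simp only [Sat, sat_subst_bound_assign h hx]

theorem sat_ex_subst {a : Expr} {p x : TIndex} (h : p.ty = x.ty) (hx : ¬ Occurs (.bound x) a)
    {v : Var → ℕ} : Sat E (.ex x (subst p (.bound x) a)) v ↔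
      ∃ n ∈ dom E x.ty, Sat E a (assign v (.free p) n) := by
  simp only [Sat, sat_subst_bound_assign h hx]

theorem sat_imp {a b : Expr} {v : Var → ℕ} : Sat E (imp a b) v ↔ (Sat E a v → Sat E b v) := by
  simp only [imp, Sat]; tauto

theorem sat_iff {a b : Expr} {v : Var → ℕ} :
    Sat E (iff a b) v ↔ (Sat E a v ↔ Sat E b v) := by
  simp only [Expr.iff, Sat, sat_imp]; tauto

/-- The valuation `v` with the variables `us` changed to the values `l`. -/
noncomputable def assigns (v : Var → ℕ) : List Var → List ℕ → Var → ℕ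
  | u :: us, n :: l => assigns (assign v u n) us l
  | _, _ => v

theorem assigns_of_notMem {us : List Var} {l : List ℕ} {v : Var → ℕ} {w : Var} (h : w ∉ us) :
    assigns v us l w = v w := by
  induction us generalizing v l with
  | nil => cases l <;> rfl
  | cons u us ih =>
    cases l with
    | nil => rfl
    | cons n l =>
      rw [assigns, ih fun hw => h (List.mem_cons_of_mem _ hw),
        assign_of_ne fun e : w = u => h (e ▸ List.mem_cons_self)]

theorem map_assigns {us : List Var} (hus : us.Nodup) {l : List ℕ} (hl : l.length = us.length)
    {v : Var → ℕ} : us.map (assigns v us l) = l := by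
  induction us generalizing v l with
  | nil => simpa using (List.length_eq_zero_iff.1 hl).symm
  | cons u us ih =>
    cases l with
    | nil => simp at hl
    | cons n l =>
      rw [List.nodup_cons] at hus
      rw [List.map_cons, assigns, ih hus.2 (by simpa using hl), assigns_of_notMem hus.1,
        assign_self]

theorem sat_alls {xs : List TIndex} {a : Expr} {v : Var → ℕ} :
    Sat E (alls xs a) v ↔ ∀ l ∈ typed E (xs.map TIndex.ty),
      Sat E a (assigns v (xs.map .bound) l) := by
  induction xs generalizing v with
  | nil => simp [alls, typed, assigns]
  | cons x xs ih =>
    change (∀ n ∈ dom E x.ty, Sat E (alls xs a) (assign v (.bound x) n)) ↔ _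
    simp only [ih]
    constructor
    · rintro h (_ | ⟨n, l⟩) hl
      · cases hl
      · rcases hl with _ | ⟨hn, hl⟩
        exact h n hn l hl
    · intro h n hn l hl
      exact h (n :: l) (.cons hn hl)

theorem occurs_subst {a : Expr} {p : TIndex} {w u : Var} (h : Occurs u (subst p w a)) :
    u = w ∨ Occurs u a := by
  have hrep : ∀ q : Var, u = replaceVar (.free p) w q → u = w ∨ u = q := by
    intro q hq
    unfold replaceVar at hq
    split_ifs at hq
    · exact Or.inl hq
    · exact Or.inr hq
  induction a with
  | zero => exact h.elim
  | one => exact h.elim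
  | app q args =>
    rcases h with h | h
    · exact (hrep q h).imp_right Or.inl
    · obtain ⟨r, hr, e⟩ := List.mem_map.1 h
      rcases hrep r e.symm with h | rfl
      · exact Or.inl h
      · exact Or.inr (Or.inr hr)
  | eq q r =>
    rcases h with h | h
    · exact (hrep q h).imp_right Or.inl
    · exact (hrep r h).imp_right Or.inr
  | and a b iha ihb | or a b iha ihb =>
    rcases h with h | h
    · exact (iha h).imp_right Or.inl
    · exact (ihb h).imp_right Or.inr
  | neg a iha => exact iha h
  | all x a iha | ex x a iha =>
    rcases h with h | h
    · exact Or.inr (Or.inl h)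
    · exact (iha h).imp_right Or.inr

/-- The replacements are made one after another; distinctness of the variables turns them into one
simultaneous assignment. -/
theorem sat_bindAll {ps xs : List TIndex} (htype : xs.map TIndex.ty = ps.map TIndex.ty)
    (hxs : xs.Nodup) (hps : ps.Nodup) {c : Expr} (hc : ∀ x ∈ xs, ¬ Occurs (.bound x) c)
    {v : Var → ℕ} : Sat E (bindAll ps xs c) v ↔
      Sat E c (assigns v (ps.map .free) (xs.map fun x => v (.bound x))) := by
  induction ps generalizing xs c v with
  | nil => cases xs <;> rfl
  | cons p ps ih =>
    cases xs with
    | nil => simp at htype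
    | cons x xs =>
      simp only [List.map_cons, List.cons.injEq] at htype
      rw [List.nodup_cons] at hxs hps
      rw [bindAll, ih htype.2 hxs.2 hps.2, sat_subst_bound htype.1.symm (hc x List.mem_cons_self)]
      · simp only [List.map_cons, assigns]
        refine iff_of_eq (congrArg _ ?_)
        have hp : Var.free p ∉ ps.map Var.free := by
          simpa using hps.1
        have hx : Var.bound x ∉ ps.map Var.free := by simp
        rw [assigns_of_notMem hx]
        -- The assignment at `p` is moved inside, past assignments at variables other than `p`.
        have key : ∀ (us : List Var) (l : List ℕ) (v : Var → ℕ) (u : Var) (n : ℕ), u ∉ us →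
            assign (assigns v us l) u n = assigns (assign v u n) us l := by
          intro us
          induction us with
          | nil => intro l v u n _; cases l <;> rfl
          | cons w us ih =>
            intro l v u n hu
            cases l with
            | nil => rfl
            | cons m l =>
              rw [List.mem_cons, not_or] at hu
              rw [assigns, assigns, ih _ _ _ _ hu.2, assign_comm hu.1]
        exact key _ _ _ _ _ hp
      · intro y hy h
        rcases occurs_subst h with h | h
        · cases h; exact hxs.1 hy
        · exact hc y (List.mem_cons_of_mem _ hy) h

end Sat

/-! ### Definability of the relations given by formulas -/

/-- The valuation given by an assignment of coordinates and constants to the free variables. -/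
def coordVal (g : TIndex → ℕ ⊕ ℕ) (t : List ℕ) : Var → ℕ
  | .free p => coord t (g p)
  | .bound _ => 0

/-- Every bound variable in a formula is quantified, so the value `0` that `coordVal` gives to bound
variables is harmless. -/
theorem IsFormula.sat_congr {Λ : Ordinal.{0}} {Id : Prop} {ν : Ordinal.{0}} {c : Expr}
    (hc : IsFormula Λ Id ν c) {E : Ordinal.{0} → ℕ → Set (List ℕ)} {v w : Var → ℕ}
    (h : ∀ p, v (.free p) = w (.free p)) : Sat E c v ↔ Sat E c w := by
  have assign_free (v w : Var → ℕ) (h : ∀ p, v (.free p) = w (.free p)) (q : TIndex) (n : ℕ)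
      (p : TIndex) : assign v (.free q) n (.free p) = assign w (.free q) n (.free p) := by
    simp only [assign, h]
  induction hc generalizing v w with
  | zero => rfl
  | one => rfl
  | @app μ p qs _ _ _ =>
    have : (qs.map Var.free).map v = (qs.map Var.free).map w := by
      simp only [List.map_map]
      exact List.map_congr_left fun q _ => h q
    simp only [Sat, this, h]
  | eq => simp only [Sat, h]
  | and _ _ iha ihb => simp only [Sat, iha h, ihb h]
  | or _ _ iha ihb => simp only [Sat, iha h, ihb h]
  | neg _ iha => simp only [Sat, iha h]
  | all _ hx hpx _ _ ih => simp only [sat_all_subst hpx hx, ih (assign_free v w h _ _)]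
  | ex _ hx hpx _ _ ih => simp only [sat_ex_subst hpx hx, ih (assign_free v w h _ _)]

/-- The quantifier step of `exists_coord`, with its induction hypothesis as `ih`: the quantified
value is prepended to the list and then projected away. -/
theorem exists_coord_ex {Λ : Ordinal.{0}} {Id : Prop} {ν : Ordinal.{0}}
    {E E' : Ordinal.{0} → ℕ → Set (List ℕ)} (hE : ∀ μ < ν, E' μ = E μ) {c : Expr} {p x : TIndex}
    (hc : IsFormula Λ Id ν c) (hpx : p.ty = x.ty) (hτ : IsType Λ x.ty) (horder : x.ty.order < ν)
    (ih : ∀ g : TIndex → ℕ ⊕ ℕ, (∀ p i, g p = .inl i → p.ty.order < ν) →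
      ∃ A ∈ definableFrom Λ E', ∀ t, (∀ p, coord t (g p) ∈ dom E p.ty) →
        (t ∈ A ↔ Sat E c (coordVal g t)))
    (g : TIndex → ℕ ⊕ ℕ) (hg : ∀ p i, g p = .inl i → p.ty.order < ν) :
    ∃ A ∈ definableFrom Λ E', ∀ t, (∀ p, coord t (g p) ∈ dom E p.ty) →
      (t ∈ A ↔ ∃ n ∈ dom E x.ty, Sat E c (assign (coordVal g t) (.free p) n)) := by
  classical
  -- The quantified variable takes position `0`; the other coordinates move up by one and constants
  -- stay.
  let g' : TIndex → ℕ ⊕ ℕ := fun q => if q = p then .inl 0 else (g q).map Nat.succ id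
  have hcoord (n : ℕ) (t : List ℕ) (q : TIndex) :
      coord (n :: t) (g' q) = if q = p then n else coord t (g q) := by
    by_cases h : q = p
    · simp [g', h, coord]
    · simp only [g', h, if_false]
      cases g q <;> simp [coord]
  obtain ⟨A, hA, hAt⟩ := ih g' fun q i hi => by
    by_cases h : q = p
    · rw [h, hpx]; exact horder
    · simp only [g', h, if_false] at hi
      cases hq : g q with
      | inl j => exact hg q j hq
      | inr m => simp [hq] at hi
  refine ⟨_, definableFamily_ex hA ⟨x.ty, hτ⟩, fun t ht => ?_⟩
  have hdom : dom E' x.ty = dom E x.ty := dom_congr hτ fun μ hμ => hE μ (hμ.trans_lt horder)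
  change (∃ n ∈ dom E' x.ty, _) ↔ _
  rw [hdom]
  refine exists_congr fun n => and_congr_right fun hn => (hAt _ fun q => ?_).trans ?_
  · rw [hcoord]
    split_ifs with h
    · rw [h, hpx]; exact hn
    · exact ht q
  · refine hc.sat_congr fun q => ?_
    simp [coordVal, assign, hcoord]

/-- Where ramification pays off. Only variables of order below `ν` may be coordinates; all others
are constants, so each prime formula is a substitution instance of a member of the family, and the
connectives and quantifiers are closure operations. -/
theorem exists_coord {Λ : Ordinal.{0}} {Id : Prop} {ν : Ordinal.{0}}
    {E E' : Ordinal.{0} → ℕ → Set (List ℕ)} (hE : ∀ μ < ν, E' μ = E μ)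
    (hν : Set.range (E ν) = definableFrom Λ E') {c : Expr} (hc : IsFormula Λ Id ν c)
    (g : TIndex → ℕ ⊕ ℕ) (hg : ∀ p i, g p = .inl i → p.ty.order < ν) :
    ∃ A ∈ definableFrom Λ E', ∀ t, (∀ p, coord t (g p) ∈ dom E p.ty) →
      (t ∈ A ↔ Sat E c (coordVal g t)) := by
  induction hc generalizing g with
  | zero => exact ⟨_, definableFamily_compl definableFamily_univ, fun t _ => by simp [Sat]⟩
  | one => exact ⟨_, definableFamily_univ, fun t _ => by simp [Sat]⟩
  | @app μ p qs htype hp horder =>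
    have hmap (t : List ℕ) :
        (qs.map Var.free).map (coordVal g t) = (qs.map g).map (coord t) := by
      simp [coordVal]
    rcases horder.lt_or_eq with hlt | rfl
    · refine ⟨_, definableFamily_subst (definableFamily_base ⟨p.ty, htype⟩) (g p :: qs.map g),
        fun t _ => ?_⟩
      have hext : ext E' p.ty = ext E p.ty := ext_congr htype fun κ hκ =>
        hE κ (hκ.trans_lt (by rw [hp]; exact hlt))
      simp only [Sat, hmap, hext, Var.type, coordVal]
      constructor
      · rintro ⟨m, l, hl, e⟩
        simp only [List.map_cons, List.cons.injEq] at e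
        rwa [e.1, e.2]
      · intro h
        exact ⟨_, _, h, rfl⟩
    -- A head of order exactly `ν` cannot be a coordinate. It is a constant `m`, and the relation
    -- numbered `m` already belongs to the family.
    · cases hgp : g p with
      | inl i => exact absurd (hg p i hgp) (by rw [hp]; exact lt_irrefl _)
      | inr m =>
        refine ⟨_, definableFamily_subst (hν ▸ ⟨m, rfl⟩ : E μ m ∈ definableFrom Λ E') (qs.map g),
          fun t ht => ?_⟩
        have htyped : (qs.map g).map (coord t) ∈ typed E (qs.map TIndex.ty) := by
          change List.Forall₂ _ _ _
          rw [List.forall₂_map_right_iff, List.map_map, List.forall₂_map_left_iff,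
            List.forall₂_same]
          exact fun q _ => ht q
        simp only [Sat, hmap, Var.type, coordVal, hgp, hp, ext]
        exact (and_iff_left htyped).symm
  | @eq p q _ _ _ _ =>
    refine ⟨_, definableFamily_subst definableFamily_eq [g p, g q], fun t _ => ?_⟩
    change (∃ a, [_, _] = [a, a]) ↔ coord t (g p) = coord t (g q)
    constructor
    · rintro ⟨a, e⟩
      simp only [List.cons.injEq, and_true] at e
      rw [e.1, e.2]
    · intro e
      exact ⟨_, by rw [e]⟩
  | and _ _ iha ihb =>
    obtain ⟨A, hA, hAt⟩ := iha g hg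
    obtain ⟨B, hB, hBt⟩ := ihb g hg
    exact ⟨_, definableFamily_inter hA hB, fun t ht => and_congr (hAt t ht) (hBt t ht)⟩
  | or _ _ iha ihb =>
    obtain ⟨A, hA, hAt⟩ := iha g hg
    obtain ⟨B, hB, hBt⟩ := ihb g hg
    refine ⟨_, definableFamily_compl (definableFamily_inter (definableFamily_compl hA)
      (definableFamily_compl hB)), fun t ht => ?_⟩
    simp only [Sat, ← hAt t ht, ← hBt t ht, Set.mem_compl_iff, Set.mem_inter_iff]
    tauto
  | neg _ iha =>
    obtain ⟨A, hA, hAt⟩ := iha g hg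
    exact ⟨_, definableFamily_compl hA, fun t ht => not_congr (hAt t ht)⟩
  | all hc hx hpx htype horder ih =>
    -- The universal quantifier is treated as `¬ ∃ ¬`.
    obtain ⟨A, hA, hAt⟩ := exists_coord_ex hE hc.neg hpx htype horder
      (fun g hg => by
        obtain ⟨A, hA, hAt⟩ := ih g hg
        exact ⟨_, definableFamily_compl hA, fun t ht => not_congr (hAt t ht)⟩) g hg
    refine ⟨_, definableFamily_compl hA, fun t ht => ?_⟩
    rw [sat_all_subst hpx hx, Set.mem_compl_iff, hAt t ht]
    simp [Sat]
  | ex hc hx hpx htype horder ih =>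
    obtain ⟨A, hA, hAt⟩ := exists_coord_ex hE hc hpx htype horder ih g hg
    exact ⟨A, hA, fun t ht => by rw [sat_ex_subst hpx hx, hAt t ht]⟩

/-! ### Soundness -/

theorem Formula.isType_of_ex {Λ : Ordinal.{0}} {Id : Prop} {x : TIndex} {a : Expr}
    (h : Formula Λ Id (.ex x a)) : IsType Λ x.ty := by
  obtain ⟨ν, _, _, h⟩ := h
  cases h
  assumption

theorem sat_comprehension {Λ : Ordinal.{0}} (hΛ : Λ.card ≤ ℵ₀) {Id : Prop} {a b : Expr}
    (h : Comprehension Λ Id a b) (hb : Formula Λ Id b) {v : Var → ℕ}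
    (hv : Admissible (rels Λ) v) : Sat (rels Λ) b v := by
  classical
  obtain ⟨ν, c, ps, xs, y, hc, hps, hxs, hty, hxc, hy, -, rfl⟩ := h
  -- Since the axiom instance is a formula, `y` has a genuine type, whose arguments have orders
  -- below `ν`.
  have hτ := hb.isType_of_ex
  rw [hy] at hτ
  cases hτ with | rel _ _ _ horder
  obtain ⟨E', hE', hr⟩ := range_rels hΛ ν
  -- The abstracted variables become positions in the list; all others are parameters frozen at
  -- their values under `v`.
  let g : TIndex → ℕ ⊕ ℕ := fun p => if p ∈ ps then .inl (ps.idxOf p) else .inr (v (.free p))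
  obtain ⟨A, hA, hAt⟩ := exists_coord hE' hr hc g fun p i hi => by
    by_cases h : p ∈ ps
    · exact horder _ (List.mem_map_of_mem h)
    · simp [g, h] at hi
  rw [← hr] at hA
  obtain ⟨m, hm, hext⟩ := exists_mem_dom (args := ps.map TIndex.ty) hA
  refine ⟨m, by rwa [hy], sat_alls.2 fun l hl => sat_iff.2 ?_⟩
  rw [hty] at hl
  -- The order of `y` exceeds the orders of the `xs`, so none of their quantifiers rebinds `y`.
  have hyx : Var.bound y ∉ xs.map Var.bound := by
    intro h
    simp only [List.mem_map, Var.bound.injEq, exists_eq_right] at h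
    have hmem : y.ty ∈ ps.map TIndex.ty := hty ▸ List.mem_map_of_mem h
    have := horder _ hmem
    rw [hy] at this
    exact lt_irrefl _ this
  have hlen : l.length = ps.length := by simpa using List.Forall₂.length_eq hl
  have hlen' : xs.length = ps.length := by simpa using congrArg List.length hty
  have hmap : (xs.map Var.bound).map (assigns (assign v (.bound y) m) (xs.map .bound) l) = l :=
    map_assigns (hxs.map fun _ _ h => by cases h; rfl) (by simp [hlen, hlen'])
  have hmap' := hmap
  rw [List.map_map] at hmap'
  rw [sat_bindAll hty hxs hps hxc]
  change (xs.map Var.bound).map _ ∈ ext _ y.ty (assigns _ _ _ (Var.bound y)) ↔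
    Sat _ c (assigns _ _ (xs.map (_ ∘ Var.bound)))
  rw [hmap, hmap', assigns_of_notMem hyx, assign_self, hy, hext, Set.mem_inter_iff,
    and_iff_left hl]
  have hval (p : TIndex) (w : Var → ℕ) (hw : ∀ q, w (.free q) = v (.free q)) :
      coord l (g p) = assigns w (ps.map .free) l (.free p) := by
    by_cases h : p ∈ ps
    · have h1 := map_assigns (v := w) (us := ps.map Var.free)
        (hps.map fun _ _ h => by cases h; rfl) (l := l) (by simpa)
      have hidx : ps.idxOf p < ps.length := List.idxOf_lt_length_of_mem h
      have h2 := congrArg (fun l => l.getD (ps.idxOf p) 0) h1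
      simp only [g, h, if_true, coord]
      rw [← h2]
      simp [List.getD, hidx]
    · rw [assigns_of_notMem (by simpa), hw]
      simp [g, h, coord]
  rw [hAt l]
  · refine hc.sat_congr fun p => ?_
    change coord l (g p) = _
    refine hval p _ fun q => ?_
    rw [assigns_of_notMem (by simp), assign_of_ne (by simp)]
  · intro p
    by_cases h : p ∈ ps
    · have hidx : ps.idxOf p < ps.length := List.idxOf_lt_length_of_mem h
      have := List.Forall₂.get hl (i := ps.idxOf p) (by rw [hlen]; exact hidx) (by simpa)
      simp only [g, h, if_true, coord]
      simpa [List.getD, hlen, hidx] using this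
    · have : v (.free p) ∈ dom (rels Λ) p.ty := hv (.free p)
      simpa [g, h, coord] using this

/-- Coextensive objects are equal numbers, so no formula `c` can separate them. -/
theorem sat_extensionality {E : Ordinal.{0} → ℕ → Set (List ℕ)} {a b : Expr}
    (h : Extensionality a b) {v : Var → ℕ} (hv : Admissible E v) (ha : Sat E a v) :
    Sat E b v := by
  obtain ⟨ν, c, p, q, r, xs, hxs, hp, hq, hr, rfl, rfl⟩ := h
  have hpv : v (.free p) ∈ dom E p.ty := hv (.free p)
  have hqv : v (.free q) ∈ dom E q.ty := hv (.free q)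
  rw [hq, hp] at hqv
  rw [hp] at hpv
  have key : v (.free p) = v (.free q) := by
    refine ext_injOn hpv hqv (Set.ext fun l => ?_)
    by_cases hl : l ∈ typed E (xs.map TIndex.ty)
    · have := sat_iff.1 (sat_alls.1 ha l hl)
      have hlen : l.length = (xs.map Var.bound).length := by
        simpa using List.Forall₂.length_eq hl
      simp only [Sat, map_assigns (hxs.map fun _ _ h => by cases h; rfl) hlen, Var.type] at this
      rwa [assigns_of_notMem (by simp), assigns_of_notMem (by simp), hq, hp] at this
    · exact iff_of_false (fun h => hl h.2) fun h => hl h.2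
  rw [sat_imp, sat_subst_free hr.symm, sat_subst_free (hq.trans hr.symm), key]
  exact id

theorem sat_identitySubst {E : Ordinal.{0} → ℕ → Set (List ℕ)} {a b : Expr}
    (h : IdentitySubst a b) {v : Var → ℕ} (ha : Sat E a v) : Sat E b v := by
  obtain ⟨c, p, q, r, hq, hr, rfl, rfl⟩ := h
  have key : v (.free p) = v (.free q) := ha
  rw [sat_imp, sat_subst_free hr.symm, sat_subst_free (hq.trans hr.symm), key]
  exact id

theorem mem_typed_pair {E : Ordinal.{0} → ℕ → Set (List ℕ)} {σ τ : RType} {a b : ℕ} :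
    [a, b] ∈ typed E [σ, τ] ↔ a ∈ dom E σ ∧ b ∈ dom E τ := by
  simp [typed]

theorem sat_infinity {Λ : Ordinal.{0}} (hΛ : Λ.card ≤ ℵ₀) {a b : Expr} (h : Infinity a b)
    (v : Var → ℕ) : Sat (rels Λ) b v := by
  obtain ⟨r, x, y, z, hr, hx, hy, hz, hxy, hxz, hyz, -, rfl⟩ := h
  obtain ⟨E', -, hrange⟩ := range_rels hΛ 1
  obtain ⟨m, hm, hext⟩ := exists_mem_dom (args := [.ind, .ind])
    (hrange.symm.subset definableFamily_lt)
  have hmem (k l : ℕ) : [k, l] ∈ ext (rels Λ) (.rel 1 [.ind, .ind]) m ↔ k < l := by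
    rw [hext, Set.mem_inter_iff, mem_typed_pair]
    simp only [Set.mem_ofPred_eq, List.cons.injEq, and_true]
    constructor
    · rintro ⟨⟨a, b, hab, rfl, rfl⟩, -⟩
      exact hab
    · exact fun h => ⟨⟨k, l, h, rfl, rfl⟩, by simp [dom]⟩
  have hrx : r ≠ x := by rintro rfl; simp [hx] at hr
  have hry : r ≠ y := by rintro rfl; simp [hy] at hr
  have hrz : r ≠ z := by rintro rfl; simp [hz] at hr
  refine ⟨m, by rwa [hr], ?_⟩
  simp only [Sat, sat_imp, Var.type, List.map_cons, List.map_nil, assign, Var.bound.injEq, hrx,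
    hry, hrz, hxy, hxz, hyz, hr, hx, hy, hz, if_true, if_false, hmem, dom, Set.mem_univ,
    true_and, forall_true_left]
  exact ⟨⟨fun n => lt_irrefl n, fun n => ⟨n + 1, n.lt_succ_self⟩⟩,
    fun i j k h => h.1.trans h.2⟩

/-- Each object, being a number, serves as its own label: the witness is equality restricted to the
domain of `τ`. -/
theorem sat_equipotence {Λ : Ordinal.{0}} (hΛ : Λ.card ≤ ℵ₀) {a b : Expr}
    (h : Equipotence a b) (v : Var → ℕ) : Sat (rels Λ) b v := by
  obtain ⟨τ, s, x, y, u, z, hs, hx, hy, hu, hz, hxy, hxu, hxz, hyz, -, rfl⟩ := h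
  obtain ⟨E', -, hrange⟩ := range_rels hΛ (τ.order + 1)
  obtain ⟨m, hm, hext⟩ := exists_mem_dom (args := [τ, .ind])
    (hrange.symm.subset definableFamily_eq)
  have hmem (k l : ℕ) : [k, l] ∈ ext (rels Λ) (.rel (τ.order + 1) [τ, .ind]) m ↔
      k = l ∧ k ∈ dom (rels Λ) τ := by
    rw [hext, Set.mem_inter_iff, mem_typed_pair]
    simp only [Set.mem_ofPred_eq, List.cons.injEq, and_true]
    constructor
    · rintro ⟨⟨a, rfl, rfl⟩, h, -⟩
      exact ⟨rfl, h⟩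
    · rintro ⟨rfl, h⟩
      exact ⟨⟨k, rfl, rfl⟩, h, by simp [dom]⟩
  have hne (w : TIndex) (hw : w.ty = τ ∨ w.ty = .ind) : s ≠ w := by
    rintro rfl
    rcases hw with hw | hw
    · have := congrArg RType.order (hs.symm.trans hw)
      exact (lt_add_one τ.order).ne' this
    · simp [hw] at hs
  refine ⟨m, by rwa [hs], ?_⟩
  simp only [Sat, sat_imp, Var.type, List.map_cons, List.map_nil, assign, Var.bound.injEq,
    hne x (.inl hx), hne y (.inl hy), hne u (.inr hu), hne z (.inr hz), hxy, hxu, hxz, hyz,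
    hxz.symm, hyz.symm, hs, hx, hy, hu, hz, if_true, if_false, hmem, dom, Set.mem_univ, true_and,
    forall_true_left]
  exact ⟨fun n hn => ⟨n, rfl, hn⟩, fun k i _ j _ h => h.1.1.trans h.2.1.symm⟩

/-- Each rule preserves implication under all admissible valuations. For an eigenvariable, the
valuation is changed at `p`, which does not affect the side where `p` does not occur. -/
theorem Thm.sound {Λ : Ordinal.{0}} {Id : Prop} {Ax : Scheme}
    {E : Ordinal.{0} → ℕ → Set (List ℕ)}
    (hAx : ∀ a b, Ax a b → Formula Λ Id a → Formula Λ Id b → ∀ v, Admissible E v →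
      Sat E a v → Sat E b v)
    {a b : Expr} (h : Thm Λ Id Ax a b) {v : Var → ℕ} (hv : Admissible E v) (ha : Sat E a v) :
    Sat E b v := by
  induction h generalizing v with
  | refl => exact ha
  | zero_left => exact ha.elim
  | one_right => trivial
  | ax h hfa hfb => exact hAx _ _ h hfa hfb v hv ha
  | cut _ _ ih₁ ih₂ => exact ih₂ hv (ih₁ hv ha)
  | and_left₁ _ _ ih => exact ih hv ha.1
  | and_left₂ _ _ ih => exact ih hv ha.2
  | or_right₁ _ _ ih => exact Or.inl (ih hv ha)
  | or_right₂ _ _ ih => exact Or.inr (ih hv ha)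
  | and_right _ _ ih₁ ih₂ => exact ⟨ih₁ hv ha, ih₂ hv ha⟩
  | or_left _ _ ih₁ ih₂ => exact ha.elim (ih₁ hv) (ih₂ hv)
  | @neg_right a b c _ ih =>
    by_cases hc : Sat E c v
    · exact Or.inl (ih hv ⟨ha, hc⟩)
    · exact Or.inr hc
  | neg_left _ ih => exact (ih hv ha.1).resolve_right ha.2
  | all_elim _ hx hp hq _ ih =>
    rw [sat_subst_free (hq.trans hp.symm)]
    exact (sat_all_subst hp hx).1 (ih hv ha) _ (hq ▸ hv (.free _))
  | ex_elim _ hx hp hq _ ih =>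
    rw [sat_subst_free (hq.trans hp.symm)] at ha
    exact ih hv ((sat_ex_subst hp hx).2 ⟨_, hq ▸ hv (.free _), ha⟩)
  | all_intro hx hp hpa _ _ ih =>
    exact (sat_all_subst hp hx).2 fun n hn =>
      ih (hv.assign (u := .free _) (show n ∈ dom E (Var.type (.free _)) by simpa only [Var.type, hp] using hn)) ((sat_assign_of_not_occurs hpa).2 ha)
  | ex_intro hx hp hpb _ _ ih =>
    obtain ⟨n, hn, h⟩ := (sat_ex_subst hp hx).1 ha
    exact (sat_assign_of_not_occurs hpb).1
      (ih (hv.assign (u := .free _) (show n ∈ dom E (Var.type (.free _)) by simpa only [Var.type, hp] using hn)) h)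

theorem consistent_extendedThm {Λ : Ordinal.{0}} (hΛ : Λ.card ≤ ℵ₀) :
    Consistent (ExtendedThm Λ) := by
  intro h
  -- The number `0` is trivially a least index, so it lies in every domain and the constant
  -- valuation is admissible.
  refine Thm.sound (E := rels Λ) ?_ h (v := fun _ => 0) (fun u => zero_mem_dom _) trivial
  rintro a b (h | h | h | ⟨p, rfl, rfl⟩ | h | h) - hb v hv ha
  · exact sat_comprehension hΛ h hb hv
  · exact sat_extensionality h hv ha
  · exact sat_infinity hΛ h v
  · exact rfl
  · exact sat_identitySubst h ha
  · exact sat_equipotence hΛ h v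

/-! ### Comparison of the calculi -/

theorem IsFormula.mono {Λ : Ordinal.{0}} {Id Id' : Prop} (hId : Id → Id') {μ ν : Ordinal.{0}}
    (hμν : μ ≤ ν) {a : Expr} (h : IsFormula Λ Id μ a) : IsFormula Λ Id' ν a := by
  induction h with
  | zero => exact .zero
  | one => exact .one
  | app htype hp horder => exact .app htype hp (horder.trans hμν)
  | eq h htype hpq horder => exact .eq (hId h) htype hpq (horder.trans hμν)
  | and _ _ iha ihb => exact .and iha ihb
  | or _ _ iha ihb => exact .or iha ihb
  | neg _ iha => exact .neg iha
  | all _ hx hpx htype horder ih => exact .all ih hx hpx htype (horder.trans_le hμν)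
  | ex _ hx hpx htype horder ih => exact .ex ih hx hpx htype (horder.trans_le hμν)

theorem Formula.mono {Λ : Ordinal.{0}} {Id Id' : Prop} (hId : Id → Id') {a : Expr}
    (h : Formula Λ Id a) : Formula Λ Id' a :=
  let ⟨ν, h0, hν, ha⟩ := h
  ⟨ν, h0, hν, ha.mono hId le_rfl⟩

theorem Comprehension.mono {Λ : Ordinal.{0}} {Id Id' : Prop} (hId : Id → Id') {a b : Expr}
    (h : Comprehension Λ Id a b) : Comprehension Λ Id' a b :=
  let ⟨ν, c, ps, xs, y, hc, h⟩ := h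
  ⟨ν, c, ps, xs, y, hc.mono hId le_rfl, h⟩

theorem Thm.mono {Λ : Ordinal.{0}} {Id Id' : Prop} (hId : Id → Id') {Ax Ax' : Scheme}
    (hAx : ∀ a b, Ax a b → Ax' a b) {a b : Expr} (h : Thm Λ Id Ax a b) : Thm Λ Id' Ax' a b := by
  induction h with
  | refl hc => exact .refl (hc.mono hId)
  | zero_left hc => exact .zero_left (hc.mono hId)
  | one_right hc => exact .one_right (hc.mono hId)
  | ax h ha hb => exact .ax (hAx _ _ h) (ha.mono hId) (hb.mono hId)
  | cut _ _ ih₁ ih₂ => exact .cut ih₁ ih₂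
  | and_left₁ hc _ ih => exact .and_left₁ (hc.mono hId) ih
  | and_left₂ hc _ ih => exact .and_left₂ (hc.mono hId) ih
  | or_right₁ hc _ ih => exact .or_right₁ (hc.mono hId) ih
  | or_right₂ hc _ ih => exact .or_right₂ (hc.mono hId) ih
  | and_right _ _ ih₁ ih₂ => exact .and_right ih₁ ih₂
  | or_left _ _ ih₁ ih₂ => exact .or_left ih₁ ih₂
  | neg_right _ ih => exact .neg_right ih
  | neg_left _ ih => exact .neg_left ih
  | all_elim hc hx hp hq _ ih => exact .all_elim (hc.mono hId) hx hp hq ih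
  | ex_elim hc hx hp hq _ ih => exact .ex_elim (hc.mono hId) hx hp hq ih
  | all_intro hx hp hpa hall _ ih => exact .all_intro hx hp hpa (hall.mono hId) ih
  | ex_intro hx hp hpb hex _ ih => exact .ex_intro hx hp hpb (hex.mono hId) ih

theorem DeductiveThm.extendedThm {Λ : Ordinal.{0}} {a b : Expr} (h : DeductiveThm Λ a b) :
    ExtendedThm Λ a b :=
  Thm.mono False.elim (fun _ _ h => by
    rcases h with h | h | h
    exacts [.inl (h.mono False.elim), .inr (.inl h), .inr (.inr (.inl h))]) h

theorem IdentityThm.extendedThm {Λ : Ordinal.{0}} {a b : Expr} (h : IdentityThm Λ a b) :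
    ExtendedThm Λ a b :=
  Thm.mono id (fun _ _ h => by tauto) h

theorem EquipotenceThm.extendedThm {Λ : Ordinal.{0}} {a b : Expr} (h : EquipotenceThm Λ a b) :
    ExtendedThm Λ a b :=
  Thm.mono id (fun _ _ h => by tauto) h

/-! ### Derived rules -/

section Formula

variable {Λ : Ordinal.{0}} {Id : Prop} {a b : Expr}

theorem Formula.neg (ha : Formula Λ Id a) : Formula Λ Id (.neg a) :=
  let ⟨ν, h0, hν, h⟩ := ha
  ⟨ν, h0, hν, h.neg⟩

theorem Formula.exists_common (ha : Formula Λ Id a) (hb : Formula Λ Id b) :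
    ∃ ν, 0 < ν ∧ ν < Λ ∧ IsFormula Λ Id ν a ∧ IsFormula Λ Id ν b := by
  obtain ⟨μ, h0, hμ, ha⟩ := ha
  obtain ⟨ν, -, hν, hb⟩ := hb
  exact ⟨max μ ν, lt_max_of_lt_left h0, max_lt hμ hν, ha.mono id (le_max_left _ _),
    hb.mono id (le_max_right _ _)⟩

theorem Formula.and (ha : Formula Λ Id a) (hb : Formula Λ Id b) : Formula Λ Id (.and a b) :=
  let ⟨ν, h0, hν, ha, hb⟩ := ha.exists_common hb
  ⟨ν, h0, hν, ha.and hb⟩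

theorem Formula.or (ha : Formula Λ Id a) (hb : Formula Λ Id b) : Formula Λ Id (.or a b) :=
  let ⟨ν, h0, hν, ha, hb⟩ := ha.exists_common hb
  ⟨ν, h0, hν, ha.or hb⟩

theorem Formula.zero (ha : Formula Λ Id a) : Formula Λ Id .zero :=
  let ⟨ν, h0, hν, _⟩ := ha
  ⟨ν, h0, hν, .zero⟩

end Formula

theorem subst_self (p : TIndex) (a : Expr) : subst p (.free p) a = a := by
  have h (u : Var) : replaceVar (.free p) (.free p) u = u := by
    unfold replaceVar
    split_ifs with h
    · exact h.symm
    · rfl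
  have h' : replaceVar (.free p) (.free p) = id := funext h
  induction a <;> simp_all [subst]

namespace Thm

variable {Λ : Ordinal.{0}} {Id : Prop} {Ax : Scheme} {g a b c : Expr}

theorem contradiction (ha : Formula Λ Id a) (h : Thm Λ Id Ax g a)
    (h' : Thm Λ Id Ax g (.neg a)) : Thm Λ Id Ax g .zero :=
  .cut (.and_right h h') (.neg_left (.or_right₂ ha.zero (.refl ha)))

theorem imp_intro (ha : Formula Λ Id a) (hb : Formula Λ Id b)
    (h : Thm Λ Id Ax (.and g a) b) : Thm Λ Id Ax g (imp a b) :=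
  .cut (.neg_right h) (.or_left (.or_right₂ ha.neg (.refl hb)) (.or_right₁ hb (.refl ha.neg)))

theorem imp_elim (ha : Formula Λ Id a) (hb : Formula Λ Id b) (h : Thm Λ Id Ax g (imp a b))
    (h' : Thm Λ Id Ax g a) : Thm Λ Id Ax g b := by
  -- From `a ∧ ¬ a ⊃ 0` follows `a ⊃ 0 ∨ ¬ ¬ a`. The double negation is needed because `neg_left`
  -- discharges the disjunct `¬ a` only against `¬ ¬ a`.
  have hdn : Thm Λ Id Ax a (.neg (.neg a)) :=
    .cut (.neg_right (.neg_left (.or_right₂ ha.zero (.refl ha))))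
      (.or_left (.zero_left ha.neg.neg) (.refl ha.neg.neg))
  have himp : Thm Λ Id Ax (imp a b) (.or b (.neg a)) :=
    .or_left (.or_right₂ hb (.refl ha.neg)) (.or_right₁ ha.neg (.refl hb))
  exact .cut (.and_right h (.cut h' hdn)) (.neg_left himp)

theorem and_comm_left (hg : Formula Λ Id g) (ha : Formula Λ Id a)
    (h : Thm Λ Id Ax (.and g a) b) : Thm Λ Id Ax (.and a g) b :=
  .cut (.and_right (.and_left₂ ha (.refl hg)) (.and_left₁ hg (.refl ha))) h

/-- The rule `or_left` carries no side assumption, so the context `g` is moved to the right as the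
premise of an implication. -/
theorem or_elim (hg : Formula Λ Id g) (ha : Formula Λ Id a) (hb : Formula Λ Id b)
    (hc : Formula Λ Id c) (h : Thm Λ Id Ax g (.or a b)) (h₁ : Thm Λ Id Ax (.and g a) c)
    (h₂ : Thm Λ Id Ax (.and g b) c) : Thm Λ Id Ax g c :=
  imp_elim hg hc (.cut h (.or_left (imp_intro hg hc (and_comm_left hg ha h₁))
    (imp_intro hg hc (and_comm_left hg hb h₂)))) (.refl hg)

theorem by_cases (hg : Formula Λ Id g) (ha : Formula Λ Id a) (hc : Formula Λ Id c)
    (h₁ : Thm Λ Id Ax (.and g a) c) (h₂ : Thm Λ Id Ax (.and g (.neg a)) c) :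
    Thm Λ Id Ax g c :=
  or_elim hg ha ha.neg hc (.neg_right (.and_left₂ hg (.refl ha))) h₁ h₂

theorem iff_mp (ha : Formula Λ Id a) (hb : Formula Λ Id b) (h : Thm Λ Id Ax g (Expr.iff a b))
    (h' : Thm Λ Id Ax g a) : Thm Λ Id Ax g b :=
  imp_elim ha hb
    (.cut h (.and_left₁ (hb.neg.or ha) (.refl (ha.neg.or hb)))) h'

theorem iff_mpr (ha : Formula Λ Id a) (hb : Formula Λ Id b) (h : Thm Λ Id Ax g (Expr.iff a b))
    (h' : Thm Λ Id Ax g b) : Thm Λ Id Ax g a :=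
  imp_elim hb ha
    (.cut h (.and_left₂ (ha.neg.or hb) (.refl (hb.neg.or ha)))) h'

/-- Instantiating at the very variable that was bound gives back `c`. The equation `e` allows the
quantified body to be written out instead of as a substitution. -/
theorem all_inst {p x : TIndex} (hc : Formula Λ Id c) (hx : ¬ Occurs (.bound x) c)
    (hp : p.ty = x.ty) (e : subst p (.bound x) c = a) (h : Thm Λ Id Ax g (.all x a)) :
    Thm Λ Id Ax g c := by
  subst e
  simpa only [subst_self] using all_elim (q := p) hc hx hp hp h

theorem ex_of_inst {p q x : TIndex} (hc : Formula Λ Id c) (hx : ¬ Occurs (.bound x) c)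
    (hp : p.ty = x.ty) (hq : q.ty = x.ty) (e : subst p (.bound x) c = a)
    (hex : Formula Λ Id (.ex x a)) (h : Thm Λ Id Ax g (subst p (.free q) c)) :
    Thm Λ Id Ax g (.ex x a) := by
  subst e
  exact .cut h (.ex_elim hc hx hp hq (.refl hex))

/-- Existential elimination in a context: `g` is moved into the conclusion `g → b`, where the
eigenvariable still does not occur. -/
theorem ex_cases {p x : TIndex} (hg : Formula Λ Id g) (hb : Formula Λ Id b)
    (hc : Formula Λ Id c) (hx : ¬ Occurs (.bound x) c) (hp : p.ty = x.ty)
    (hpg : ¬ Occurs (.free p) g) (hpb : ¬ Occurs (.free p) b)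
    (e : subst p (.bound x) c = a) (hex : Formula Λ Id (.ex x a))
    (h : Thm Λ Id Ax g (.ex x a)) (h' : Thm Λ Id Ax (.and g c) b) : Thm Λ Id Ax g b := by
  subst e
  exact imp_elim hg hb (.cut h (.ex_intro hx hp (fun h => h.elim hpg hpb) hex
    (imp_intro hg hb (and_comm_left hg hc h')))) (.refl hg)

end Thm

theorem IsFormula.all_of_eq {Λ : Ordinal.{0}} {Id : Prop} {ν : Ordinal.{0}} {a c : Expr}
    {p x : TIndex} (hc : IsFormula Λ Id ν c) (hx : ¬ Occurs (.bound x) c) (hpx : p.ty = x.ty)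
    (htype : IsType Λ x.ty) (horder : x.ty.order < ν) (e : subst p (.bound x) c = a) :
    IsFormula Λ Id ν (.all x a) :=
  e ▸ .all hc hx hpx htype horder

theorem IsFormula.ex_of_eq {Λ : Ordinal.{0}} {Id : Prop} {ν : Ordinal.{0}} {a c : Expr}
    {p x : TIndex} (hc : IsFormula Λ Id ν c) (hx : ¬ Occurs (.bound x) c) (hpx : p.ty = x.ty)
    (htype : IsType Λ x.ty) (horder : x.ty.order < ν) (e : subst p (.bound x) c = a) :
    IsFormula Λ Id ν (.ex x a) :=
  e ▸ .ex hc hx hpx htype horder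

/-! ### The diagonal argument -/

/-- The type of sets of individuals of order `ν`. -/
abbrev setType (ν : Ordinal.{0}) : RType := .rel ν [.ind]

/-- The type of the relations between sets of order `ν` and individuals. -/
abbrev labelType (ν : Ordinal.{0}) : RType := .rel (ν + 1) [setType ν, .ind]

/-- `∀ x ∃ u s x u`: every set of order `ν` has a label. -/
def labelTotal (ν : Ordinal.{0}) (s : Var) : Expr :=
  .all ⟨setType ν, 0⟩ (.ex ⟨.ind, 4⟩ (.app s [.bound ⟨setType ν, 0⟩, .bound ⟨.ind, 4⟩]))

/-- `(s x z ∧ s y z) → x = y`. -/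
def labelInjAt (s x y z : Var) : Expr :=
  imp (.and (.app s [x, z]) (.app s [y, z])) (.eq x y)

/-- `∀ z ∀ x ∀ y ((s x z ∧ s y z) → x = y)`: different sets of order `ν` have no common label. -/
def labelInj (ν : Ordinal.{0}) (s : Var) : Expr :=
  .all ⟨.ind, 5⟩ (.all ⟨setType ν, 0⟩ (.all ⟨setType ν, 1⟩
    (labelInjAt s (.bound ⟨setType ν, 0⟩) (.bound ⟨setType ν, 1⟩) (.bound ⟨.ind, 5⟩))))

/-- `s x z ∧ ¬ x z`. -/
def diagAt (s x z : Var) : Expr := .and (.app s [x, z]) (.neg (.app x [z]))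

/-- `∃ x (s x z ∧ ¬ x z)`: the individual `z` is a label of a set that does not contain it. -/
def diag (ν : Ordinal.{0}) (s z : Var) : Expr :=
  .ex ⟨setType ν, 0⟩ (diagAt s (.bound ⟨setType ν, 0⟩) z)

/-- `∀ z (y z ↔ ∃ x (s x z ∧ ¬ x z))`. -/
def diagComp (ν : Ordinal.{0}) (s y : Var) : Expr :=
  .all ⟨.ind, 4⟩ (iff (.app y [.bound ⟨.ind, 4⟩]) (diag ν s (.bound ⟨.ind, 4⟩)))

/-- `∀ z (y z ↔ x z)`. -/
def coext (k : ℕ) (y x : Var) : Expr :=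
  .all ⟨.ind, k⟩ (iff (.app y [.bound ⟨.ind, k⟩]) (.app x [.bound ⟨.ind, k⟩]))

/-- `∃ x ∀ z (y z ↔ x z)` with `x` of order `ν`. -/
def reducible (ν : Ordinal.{0}) (j k : ℕ) (y : Var) : Expr :=
  .ex ⟨setType ν, j⟩ (coext k y (.bound ⟨setType ν, j⟩))

theorem order_lt_add (ν : Ordinal.{0}) : ν < ν + 1 ∧ ν + 1 < ν + 2 ∧ ν + 2 < ν + 3 := by
  refine ⟨lt_add_one ν, ?_, ?_⟩
  · exact (add_lt_add_iff_left ν).2 one_lt_two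
  · exact (add_lt_add_iff_left ν).2 (by norm_num)

section

variable {Λ ν : Ordinal.{0}}

theorem isType_setType {μ : Ordinal.{0}} (hμ : 0 < μ) (h : μ < Λ) : IsType Λ (setType μ) :=
  .rel hμ h (by simpa using IsType.ind) (fun τ h => by rw [List.mem_singleton.1 h]; exact hμ)

theorem isType_labelType (hν : 0 < ν) (h : ν + 1 < Λ) : IsType Λ (labelType ν) := by
  have h1 : ν < ν + 1 := lt_add_one ν
  refine .rel (hν.trans h1) h ?_ ?_
  · simpa using ⟨isType_setType hν (h1.trans h), IsType.ind⟩
  · simp [RType.order]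

theorem isFormula_app_set {Id : Prop} {κ μ : Ordinal.{0}} {m n : ℕ}
    (h : IsType Λ (setType μ)) (hμ : μ ≤ κ) :
    IsFormula Λ Id κ (.app (.free ⟨setType μ, m⟩) [.free ⟨.ind, n⟩]) :=
  .app (qs := [⟨.ind, n⟩]) h rfl hμ

theorem isFormula_app_label {Id : Prop} {κ : Ordinal.{0}} {l m n : ℕ}
    (h : IsType Λ (labelType ν)) (hμ : ν + 1 ≤ κ) :
    IsFormula Λ Id κ (.app (.free ⟨labelType ν, l⟩) [.free ⟨setType ν, m⟩, .free ⟨.ind, n⟩]) :=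
  .app (qs := [⟨setType ν, m⟩, ⟨.ind, n⟩]) h rfl hμ

theorem isFormula_diagAt {Id : Prop} {κ : Ordinal.{0}} {l m n : ℕ} (hν : 0 < ν)
    (h : ν + 1 < Λ) (hκ : ν + 1 ≤ κ) : IsFormula Λ Id κ
      (diagAt (.free ⟨labelType ν, l⟩) (.free ⟨setType ν, m⟩) (.free ⟨.ind, n⟩)) :=
  (isFormula_app_label (isType_labelType hν h) hκ).and
    (isFormula_app_set (isType_setType hν ((lt_add_one ν).trans h))
      ((lt_add_one ν).le.trans hκ)).neg

theorem isFormula_diag {Id : Prop} {κ : Ordinal.{0}} {l n : ℕ} (hν : 0 < ν) (h : ν + 1 < Λ)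
    (hκ : ν + 1 ≤ κ) :
    IsFormula Λ Id κ (diag ν (.free ⟨labelType ν, l⟩) (.free ⟨.ind, n⟩)) :=
  (isFormula_diagAt (l := l) (m := 0) (n := n) hν h hκ).ex_of_eq (p := ⟨setType ν, 0⟩)
    (by simp [diagAt, Occurs]) rfl (isType_setType hν ((lt_add_one ν).trans h))
    ((lt_add_one ν).trans_le hκ) (by simp [diagAt, subst, replaceVar])

end

theorem refutable_reducibility {Λ ν : Ordinal.{0}} (hν : 0 < ν) (hΛ : ν + 3 < Λ) (i j k : ℕ) :
    Refutable (EquipotenceThm Λ) (reducibility ν i j k) := by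
  obtain ⟨h1, h2, h3⟩ := order_lt_add ν
  -- Reducibility quantifies over order `ν+2`, so `ν+3` serves as a common order for all formulas of
  -- the derivation.
  have hN : (0 : Ordinal) < ν + 3 := hν.trans (h1.trans (h2.trans h3))
  have hτ : IsType Λ (setType ν) := isType_setType hν (h1.trans (h2.trans (h3.trans hΛ)))
  have hρ : IsType Λ (setType (ν + 2)) := isType_setType (hν.trans (h1.trans h2)) (h3.trans hΛ)
  have hσ : IsType Λ (labelType ν) := isType_labelType hν (h2.trans (h3.trans hΛ))
  have toF {a : Expr} (h : IsFormula Λ True (ν + 3) a) : Formula Λ True a := ⟨_, hN, hΛ, h⟩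
  -- The eigenvariables: `S` the labelling, `Y` the diagonal set, `Q` its reduction to order `ν`,
  -- `U` a label of `Q`, `P` a set with label `U` not containing `U`. Their indices are pairwise
  -- distinct.
  let P : TIndex := ⟨setType ν, 0⟩
  let Q : TIndex := ⟨setType ν, 1⟩
  let S : TIndex := ⟨labelType ν, 2⟩
  let Y : TIndex := ⟨setType (ν + 2), 3⟩
  let U : TIndex := ⟨.ind, 4⟩
  -- the formulas
  have fYU : IsFormula Λ True (ν + 3) (.app (.free Y) [.free U]) := isFormula_app_set hρ h3.le
  have fQU : IsFormula Λ True (ν + 3) (.app (.free Q) [.free U]) :=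
    isFormula_app_set hτ (h1.trans (h2.trans h3)).le
  have fPU : IsFormula Λ True (ν + 3) (.app (.free P) [.free U]) :=
    isFormula_app_set hτ (h1.trans (h2.trans h3)).le
  have fSQ : IsFormula Λ True (ν + 3) (.app (.free S) [.free Q, .free U]) :=
    isFormula_app_label hσ (h2.trans h3).le
  have fSP : IsFormula Λ True (ν + 3) (.app (.free S) [.free P, .free U]) :=
    isFormula_app_label hσ (h2.trans h3).le
  have fPQ : IsFormula Λ True (ν + 3) (.eq (.free P) (.free Q)) :=
    .eq trivial hτ rfl (h1.trans (h2.trans h3)).le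
  have fdiagP : IsFormula Λ True (ν + 3) (diagAt (.free S) (.free P) (.free U)) := fSP.and fPU.neg
  have fdiag : IsFormula Λ True (ν + 3) (diag ν (.free S) (.free U)) :=
    isFormula_diag hν (h2.trans (h3.trans hΛ)) (h2.trans h3).le
  have fdiagC : IsFormula Λ True (ν + 3) (diagComp ν (.free S) (.free Y)) :=
    (((fYU.neg.or fdiag).and (fdiag.neg.or fYU))).all_of_eq (p := U)
      (by simp [diag, diagAt, Occurs]) rfl .ind hN
      (by simp [U, Y, S, Expr.iff, imp, diag, diagAt, subst, replaceVar])
  have fexdiagC : IsFormula Λ True (ν + 3)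
      (.ex ⟨setType (ν + 2), 3⟩ (diagComp ν (.free S) (.bound ⟨setType (ν + 2), 3⟩))) :=
    fdiagC.ex_of_eq (p := Y) (by simp [diagComp, Expr.iff, imp, diag, diagAt, Occurs]) rfl hρ h3
      (by simp [Y, S, diagComp, Expr.iff, imp, diag, diagAt, subst, replaceVar])
  have fcoextU : IsFormula Λ True (ν + 3)
      (iff (.app (.free Y) [.free U]) (.app (.free Q) [.free U])) :=
    (fYU.neg.or fQU).and (fQU.neg.or fYU)
  have fcoext : IsFormula Λ True (ν + 3) (coext k (.free Y) (.free Q)) :=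
    fcoextU.all_of_eq (p := U) (by simp [Expr.iff, imp, Occurs]) rfl .ind hN
      (by simp [U, Y, Q, Expr.iff, imp, subst, replaceVar])
  have fred : IsFormula Λ True (ν + 3) (reducible ν j k (.free Y)) :=
    fcoext.ex_of_eq (p := Q) (by simp [coext, Expr.iff, imp, Occurs]) rfl hτ
      (h1.trans (h2.trans h3))
      (by simp [Y, Q, coext, Expr.iff, imp, subst, replaceVar])
  have ered : subst Y (.bound ⟨setType (ν + 2), i⟩) (reducible ν j k (.free Y)) =
      reducible ν j k (.bound ⟨setType (ν + 2), i⟩) := by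
    simp [Y, reducible, coext, Expr.iff, imp, subst, replaceVar]
  have ored : ¬ Occurs (.bound ⟨setType (ν + 2), i⟩) (reducible ν j k (.free Y)) := by
    simp [reducible, coext, Expr.iff, imp, Occurs]
  have fR : IsFormula Λ True (ν + 3) (reducibility ν i j k) :=
    fred.all_of_eq (p := Y) ored rfl hρ h3 ered
  have fexSQ : IsFormula Λ True (ν + 3)
      (.ex ⟨.ind, 4⟩ (.app (.free S) [.free Q, .bound ⟨.ind, 4⟩])) :=
    fSQ.ex_of_eq (p := U) (by simp [Occurs]) rfl .ind hN (by simp [U, S, Q, subst, replaceVar])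
  have etot : subst Q (.bound ⟨setType ν, 0⟩)
      (.ex ⟨.ind, 4⟩ (.app (.free S) [.free Q, .bound ⟨.ind, 4⟩])) =
      .ex ⟨.ind, 4⟩ (.app (.free S) [.bound ⟨setType ν, 0⟩, .bound ⟨.ind, 4⟩]) := by
    simp [S, Q, subst, replaceVar]
  have ftot : IsFormula Λ True (ν + 3) (labelTotal ν (.free S)) :=
    fexSQ.all_of_eq (p := Q) (by simp [Occurs]) rfl hτ (h1.trans (h2.trans h3)) etot
  have finj₀ : IsFormula Λ True (ν + 3)
      (labelInjAt (.free S) (.free P) (.free Q) (.free U)) := (fSP.and fSQ).neg.or fPQ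
  have oinj₀ (x : TIndex) :
      ¬ Occurs (.bound x) (labelInjAt (.free S) (.free P) (.free Q) (.free U)) := by
    simp [labelInjAt, imp, Occurs]
  have einj₀ : subst Q (.bound ⟨setType ν, 1⟩)
      (labelInjAt (.free S) (.free P) (.free Q) (.free U)) =
      labelInjAt (.free S) (.free P) (.bound ⟨setType ν, 1⟩) (.free U) := by
    simp [S, P, Q, U, labelInjAt, imp, subst, replaceVar]
  have finj₁ := finj₀.all_of_eq (p := Q) (oinj₀ ⟨setType ν, 1⟩) rfl hτ (h1.trans (h2.trans h3)) einj₀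
  have oinj₁ : ¬ Occurs (.bound ⟨setType ν, 0⟩) (.all ⟨setType ν, 1⟩
      (labelInjAt (.free S) (.free P) (.bound ⟨setType ν, 1⟩) (.free U))) := by
    simp [labelInjAt, imp, Occurs]
  have einj₁ : subst P (.bound ⟨setType ν, 0⟩) (.all ⟨setType ν, 1⟩
      (labelInjAt (.free S) (.free P) (.bound ⟨setType ν, 1⟩) (.free U))) =
      .all ⟨setType ν, 1⟩
        (labelInjAt (.free S) (.bound ⟨setType ν, 0⟩) (.bound ⟨setType ν, 1⟩) (.free U)) := by
    simp [S, P, U, labelInjAt, imp, subst, replaceVar]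
  have finj₂ := finj₁.all_of_eq (p := P) oinj₁ rfl hτ (h1.trans (h2.trans h3)) einj₁
  have oinj₂ : ¬ Occurs (.bound ⟨.ind, 5⟩) (.all ⟨setType ν, 0⟩ (.all ⟨setType ν, 1⟩
      (labelInjAt (.free S) (.bound ⟨setType ν, 0⟩) (.bound ⟨setType ν, 1⟩) (.free U)))) := by
    simp [labelInjAt, imp, Occurs]
  have einj₂ : subst U (.bound ⟨.ind, 5⟩) (.all ⟨setType ν, 0⟩ (.all ⟨setType ν, 1⟩
      (labelInjAt (.free S) (.bound ⟨setType ν, 0⟩) (.bound ⟨setType ν, 1⟩) (.free U)))) =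
      .all ⟨setType ν, 0⟩ (.all ⟨setType ν, 1⟩ (labelInjAt (.free S) (.bound ⟨setType ν, 0⟩)
        (.bound ⟨setType ν, 1⟩) (.bound ⟨.ind, 5⟩))) := by
    simp [S, U, labelInjAt, imp, subst, replaceVar]
  have finj : IsFormula Λ True (ν + 3) (labelInj ν (.free S)) :=
    finj₂.all_of_eq (p := U) oinj₂ rfl .ind hN einj₂
  have fexlabel : IsFormula Λ True (ν + 3) (.ex ⟨labelType ν, 2⟩
      (.and (labelTotal ν (.bound ⟨labelType ν, 2⟩)) (labelInj ν (.bound ⟨labelType ν, 2⟩)))) :=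
    (ftot.and finj).ex_of_eq (p := S)
      (by simp [labelTotal, labelInj, labelInjAt, imp, Occurs]) rfl hσ (h2.trans h3)
      (by simp [S, labelTotal, labelInj, labelInjAt, imp, subst, replaceVar])
  -- the derivation
  let Ax : Scheme := fun a b => Comprehension Λ True a b ∨ Infinity a b ∨
    IdentityRefl a b ∨ IdentitySubst a b ∨ Equipotence a b
  change Thm Λ True Ax _ _
  refine Thm.ex_cases (toF fR) (toF .zero) (toF (ftot.and finj)) (p := S)
    (x := ⟨labelType ν, 2⟩) (a := .and (labelTotal ν (.bound ⟨labelType ν, 2⟩))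
      (labelInj ν (.bound ⟨labelType ν, 2⟩)))
    (by simp [labelTotal, labelInj, labelInjAt, imp, Occurs]) rfl
    (by simp [S, reducibility, Expr.iff, imp, Occurs]) (by simp [Occurs])
    (by simp [S, labelTotal, labelInj, labelInjAt, imp, subst, replaceVar]) (toF fexlabel)
    (.cut (.one_right (toF fR)) (.ax (.inr (.inr (.inr (.inr ?_)))) (toF .one) (toF fexlabel))) ?_
  · exact ⟨setType ν, ⟨labelType ν, 2⟩, ⟨setType ν, 0⟩, ⟨setType ν, 1⟩, ⟨.ind, 4⟩, ⟨.ind, 5⟩, rfl,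
      rfl, rfl, rfl, rfl, by simp, by simp, by simp, by simp, rfl, rfl⟩
  have fg₁ := fR.and (ftot.and finj)
  refine Thm.ex_cases (toF fg₁) (toF .zero) (toF fdiagC) (p := Y) (x := ⟨setType (ν + 2), 3⟩)
    (by simp [diagComp, Expr.iff, imp, diag, diagAt, Occurs]) rfl
    (by simp [S, Y, reducibility, labelTotal, labelInj, labelInjAt, Expr.iff, imp, Occurs])
    (by simp [Occurs])
    (by simp [Y, S, diagComp, Expr.iff, imp, diag, diagAt, subst, replaceVar]) (toF fexdiagC)
    (.cut (.one_right (toF fg₁)) (.ax (.inl ?_) (toF .one) (toF fexdiagC))) ?_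
  -- The diagonal formula already has order `ν+1`; it is used at order `ν+2` to match the premise of
  -- reducibility.
  · refine ⟨ν + 2, diag ν (.free S) (.free U), [U], [⟨.ind, 4⟩], ⟨setType (ν + 2), 3⟩,
      isFormula_diag hν (h2.trans (h3.trans hΛ)) h2.le, by simp, by simp, rfl,
      by simp [diag, diagAt, Occurs], rfl, rfl, ?_⟩
    simp [S, U, diagComp, alls, bindAll, diag, diagAt, subst, replaceVar]
  have fg₂ := fg₁.and fdiagC
  refine Thm.ex_cases (toF fg₂) (toF .zero) (toF fcoext) (p := Q) (x := ⟨setType ν, j⟩)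
    (by simp [coext, Expr.iff, imp, Occurs]) rfl
    (by simp [S, Y, Q, reducibility, labelTotal, labelInj, labelInjAt, diagComp, diag, diagAt,
      Expr.iff, imp, Occurs]) (by simp [Occurs])
    (by simp [Y, Q, coext, Expr.iff, imp, subst, replaceVar]) (toF fred)
    (Thm.all_inst (p := Y) (toF fred) ored rfl ered (.and_left₁ (toF fdiagC)
      (.and_left₁ (toF (ftot.and finj)) (.refl (toF fR))))) ?_
  have fg₃ := fg₂.and fcoext
  refine Thm.ex_cases (toF fg₃) (toF .zero) (toF fSQ) (p := U) (x := ⟨.ind, 4⟩)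
    (by simp [Occurs]) rfl
    (by simp [S, Y, Q, U, reducibility, labelTotal, labelInj, labelInjAt, diagComp, diag, diagAt,
      coext, Expr.iff, imp, Occurs]) (by simp [Occurs])
    (by simp [U, S, Q, subst, replaceVar]) (toF fexSQ)
    (Thm.all_inst (p := Q) (x := ⟨setType ν, 0⟩) (toF fexSQ) (by simp [Occurs]) rfl etot (.and_left₁ (toF fcoext)
      (.and_left₁ (toF fdiagC) (.and_left₂ (toF fR) (.and_left₁ (toF finj)
        (.refl (toF ftot))))))) ?_
  have fg₄ := fg₃.and fSQ
  have hYdiag {a : Expr} (h : Thm Λ True Ax a _) :=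
    Thm.all_inst (p := U) (x := ⟨.ind, 4⟩) (g := a)
      (c := iff (.app (.free Y) [.free U]) (diag ν (.free S) (.free U)))
      (toF ((fYU.neg.or fdiag).and (fdiag.neg.or fYU)))
      (by simp [Expr.iff, imp, diag, diagAt, Occurs]) rfl
      (by simp [U, Y, S, Expr.iff, imp, diag, diagAt, subst, replaceVar])
      (.cut h (.and_left₁ (toF fSQ) (.and_left₁ (toF fcoext)
        (.and_left₂ (toF fg₁) (.refl (toF fdiagC))))))
  have hYQ {a : Expr} (h : Thm Λ True Ax a _) :=
    Thm.all_inst (p := U) (x := ⟨.ind, k⟩) (g := a) (toF fcoextU)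
      (by simp [Expr.iff, imp, Occurs]) rfl
      (by simp [U, Y, Q, Expr.iff, imp, subst, replaceVar])
      (.cut h (.and_left₁ (toF fSQ) (.and_left₂ (toF fg₂) (.refl (toF fcoext)))))
  -- Does the label `U` of `Q` belong to `Q`?
  refine Thm.by_cases (toF fg₄) (toF fQU) (toF .zero) ?_ ?_
  · have fg₅ := fg₄.and fQU
    have h₄ := Thm.and_left₁ (Ax := Ax) (toF fQU) (.refl (toF fg₄))
    -- If it does, it belongs to `Y`, so some `P` has label `U` and does not contain it; injectivity
    -- will give `P = Q`.
    refine Thm.ex_cases (toF fg₅) (toF .zero) (toF fdiagP) (p := P) (x := ⟨setType ν, 0⟩)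
      (by simp [diagAt, Occurs]) rfl
      (by simp [P, S, Y, Q, U, reducibility, labelTotal, labelInj, labelInjAt, diagComp, diag,
        diagAt, coext, Expr.iff, imp, Occurs]) (by simp [Occurs])
      (by simp [P, S, U, diagAt, subst, replaceVar]) (toF fdiag)
      (Thm.iff_mp (toF fYU) (toF fdiag) (hYdiag h₄) (Thm.iff_mpr (toF fYU) (toF fQU) (hYQ h₄)
        (.and_left₂ (toF fg₄) (.refl (toF fQU))))) ?_
    refine Thm.contradiction (toF fQU) (.and_left₁ (toF fdiagP) (.and_left₂ (toF fg₄)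
      (.refl (toF fQU)))) ?_
    have hdiagP := Thm.and_left₂ (Ax := Ax) (toF fg₅) (.refl (toF fdiagP))
    refine Thm.imp_elim (toF fPU.neg) (toF fQU.neg) ?_
      (.cut hdiagP (.and_left₂ (toF fSP) (.refl (toF fPU.neg))))
    refine .cut (Thm.imp_elim (toF (fSP.and fSQ)) (toF fPQ)
      (Thm.all_inst (p := Q) (toF finj₀) (oinj₀ ⟨setType ν, 1⟩) rfl einj₀ (Thm.all_inst (p := P) (toF finj₁) oinj₁ rfl einj₁
        (Thm.all_inst (p := U) (toF finj₂) oinj₂ rfl einj₂ (.and_left₁ (toF fdiagP) (.cut h₄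
          (.and_left₁ (toF fSQ) (.and_left₁ (toF fcoext) (.and_left₁ (toF fdiagC)
            (.and_left₂ (toF fR) (.and_left₂ (toF ftot) (.refl (toF finj)))))))))))) ?_)
      -- Identity is applied to the formula `¬ P U` in the variable `P`, carrying it over to `¬ Q
      -- U`.
      (.ax (.inr (.inr (.inr (.inl ⟨.neg (.app (.free P) [.free U]), P, Q, P, rfl, rfl, rfl, ?_⟩))))
        (toF fPQ) (toF (fPU.neg.neg.or fQU.neg)))
    · exact .and_right (.cut hdiagP (.and_left₁ (toF fPU.neg) (.refl (toF fSP))))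
        (.and_left₁ (toF fdiagP) (.cut h₄ (.and_left₂ (toF fg₃) (.refl (toF fSQ)))))
    · simp [P, Q, U, imp, subst, replaceVar]
  · have h₄ := Thm.and_left₁ (Ax := Ax) (toF fQU.neg) (.refl (toF fg₄))
    have hnQ := Thm.and_left₂ (Ax := Ax) (toF fg₄) (.refl (toF fQU.neg))
    refine Thm.contradiction (toF fQU) (Thm.iff_mp (toF fYU) (toF fQU) (hYQ h₄)
      (Thm.iff_mpr (toF fYU) (toF fdiag) (hYdiag h₄) ?_)) hnQ
    -- If it does not, `Q` itself witnesses that `U` lies in `Y`, hence in `Q`.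
    refine Thm.ex_of_inst (toF fdiagP) (p := P) (q := Q) (x := ⟨setType ν, 0⟩)
      (by simp [diagAt, Occurs]) rfl rfl
      (by simp [P, S, U, diagAt, subst, replaceVar]) (toF fdiag) ?_
    have e : subst P (.free Q) (diagAt (.free S) (.free P) (.free U)) =
        diagAt (.free S) (.free Q) (.free U) := by
      simp [P, S, U, diagAt, subst, replaceVar]
    rw [e]
    exact .and_right (.cut h₄ (.and_left₂ (toF fg₃) (.refl (toF fSQ)))) hnQ

end Ramified

theorem mainTheorem4 (Λ : Ordinal.{0}) (hΛ : Λ.card ≤ ℵ₀) :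
    Ramified.Consistent (Ramified.IdentityThm Λ) ∧
    Ramified.Consistent (Ramified.EquipotenceThm Λ) ∧
    Ramified.Consistent (Ramified.ExtendedThm Λ) ∧
    ∀ ν : Ordinal.{0}, 0 < ν → ν + 3 < Λ → ∀ i j k : ℕ,
      Ramified.Refutable (Ramified.EquipotenceThm Λ) (Ramified.reducibility ν i j k) ∧
      ¬ Ramified.Provable (Ramified.EquipotenceThm Λ) (Ramified.reducibility ν i j k) ∧
      ¬ Ramified.Provable (Ramified.ExtendedThm Λ) (Ramified.reducibility ν i j k) ∧
      ¬ Ramified.Provable (Ramified.IdentityThm Λ) (Ramified.reducibility ν i j k) ∧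
      ¬ Ramified.Provable (Ramified.DeductiveThm Λ) (Ramified.reducibility ν i j k) := by
  have hcon := Ramified.consistent_extendedThm hΛ
  refine ⟨fun h => hcon h.extendedThm, fun h => hcon h.extendedThm, hcon, fun ν hν h i j k => ?_⟩
  have href := Ramified.refutable_reducibility hν h i j k
  -- A proof followed by the refutation would give `1 ⊃ 0` by cut; the weaker calculi inherit
  -- unprovability by inclusion.
  have hnot : ¬ Ramified.Provable (Ramified.ExtendedThm Λ) (Ramified.reducibility ν i j k) :=
    fun hp => hcon (Ramified.Thm.cut hp (Ramified.EquipotenceThm.extendedThm href))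
  exact ⟨href, fun hp => hnot (Ramified.EquipotenceThm.extendedThm hp), hnot,
    fun hp => hnot (Ramified.IdentityThm.extendedThm hp),
    fun hp => hnot (Ramified.DeductiveThm.extendedThm hp)⟩
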